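/- An mm-space $X=(X,d_X,\mu_X)$ is a complete separable metric space with a Borel probability measure; it is identified, up to mm-isomorphism, with the support of $\mu_X$, and $\mathcal X$ denotes the set of mm-isomorphism classes. Write $Y\prec X$ if there is a $1$-Lipschitz map $f:X\to Y$ with $f_*\mu_X=\mu_Y$. The box distance $\square(X,Y)$ is the infimum of $\max\{\operatorname{dis}(S),1-\pi(S)\}$ over all couplings $\pi$ of $\mu_X,\mu_Y$ and all Borel sets $S\subset X\times Y$, where $\operatorname{dis}(S)=\sup\{|d_X(x,x')-d_Y(y,y')| : (x,y),(x',y')\in S\}$ (and $\operatorname{dis}(\emptyset)=0$). A pyramid is a nonempty, $\square$-closed subset of $\mathcal X$ that is downward closed and directed with respect to $\prec$. Pyramids $\mathcal P_k$ converge weakly to a pyramid $\mathcal P$ if $\lim_k\square(X,\mathcal P_k)=0$ for all $X\in\mathcal P$ and $\liminf_k\square(X,\mathcal P_k)>0$ for all $X\in\mathcal X\setminus\mathcal P$. For $m\in\mathbb N$ let $\mathcal M(\mathcal P;m,m)$ be the set of Borel probability measures $\nu$ on $(\mathbb R^m,\|\cdot\|_\infty)$ supported in the ball $B=\{\|x\|_\infty\le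 m\}$ with $(B,\|\cdot\|_\infty,\nu)\in\mathcal P$, and put \[\rho(\mathcal P,\mathcal Q)=\sum_{m=1}^\infty\frac1{2^m}\cdot\frac1{2m}\,(d_{\mathrm P})_{\mathrm H}\bigl(\mathcal M(\mathcal P;m,m),\mathcal M(\mathcal Q;m,m)\bigr),\] where $(d_{\mathrm P})_{\mathrm H}$ is the Hausdorff distance of the Prokhorov distance. For $N\in\{1,2,\dots\}\cup\{\infty\}$ let $[N]=\{n\in\mathbb N : n\le N\}$. A weight of length $N$ is a sequence $A=(a_n)_{n\in[N]}$ of positive reals with $\sum_n a_n=1$; for weights $A,B$, $\|A-B\|_1$ is the $\ell^1$-norm of the difference of their extensions by $0$. For pyramids $\mathcal P_n$, $n\in[N]$, the direct sum $\sum_{n=1}^N\mathcal P_n^{a_n}$ is the set of all $X\in\mathcal X$ for which there are $X_n\in\mathcal P_n$ and $1$-Lipschitz maps $f_n:X_n\to X$, $n\in[N]$, with $\mu_X=\sum_{n=1}^N a_n(f_n)_*\mu_{X_n}$. Theorem. (1) Let $A=(a_n)_{n=1}^N$ and $B=(b_n)_{n=1}^{N'}$ be weights and $\{\mathcal P_n\}_{n=1}^N$,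 $\{\mathcal Q_n\}_{n=1}^{N'}$ sequences of pyramids. Then for every integer $M$ with $1\le M\le\min\{N,N'\}$, \[\rho\Bigl(\sum_{n=1}^N\mathcal P_n^{a_n},\sum_{n=1}^{N'}\mathcal Q_n^{b_n}\Bigr)\le\sum_{n=1}^M\rho(\mathcal P_n,\mathcal Q_n)+\frac12\|A-B\|_1+\frac12\sum_{n=M+1}^N a_n+\frac12\sum_{n=M+1}^{N'}b_n .\] (2) Let $A=(a_n)_{n=1}^N$ and $A_k=(a_{nk})_{n=1}^N$, $k\in\mathbb N$, be weights of the same length $N$, and let $\{\mathcal P_n\}_{n=1}^N$ and $\{\mathcal P_{nk}\}_{n=1}^N$, $k\in\mathbb N$, be sequences of pyramids. If $\|A_k-A\|_1\to0$ and, for each $n\in[N]$, $\mathcal P_{nk}$ converges weakly to $\mathcal P_n$ as $k\to\infty$, then the direct sums $\sum_{n=1}^N\mathcal P_{nk}^{a_{nk}}$, $k\in\mathbb N$, and $\sum_{n=1}^N\mathcal P_n^{a_n}$ are pyramids, and $\sum_{n=1}^N\mathcal P_{nk}^{a_{nk}}$ converges weakly to $\sum_{n=1}^N\mathcal P_n^{a_n}$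 as $k\to\infty$. -/

import Mathlib

open Set Filter Topology MeasureTheory
open scoped ENNReal NNReal

/-- An mm-space: a complete separable metric space with a Borel probability measure. -/
structure MMSpace where
  carrier : Type
  [metric : MetricSpace carrier]
  [complete : CompleteSpace carrier]
  [separable : TopologicalSpace.SeparableSpace carrier]
  [measurable : MeasurableSpace carrier]
  [borel : BorelSpace carrier]
  μ : Measure carrier
  [isProb : IsProbabilityMeasure μ]

namespace MMSpace

attribute [instance] metric complete separable measurable borel isProb

instance : CoeSort MMSpace Type := ⟨carrier⟩

instance (X : MMSpace) : SecondCountableTopology X :=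
  UniformSpace.secondCountable_of_separable X.carrier

/-- The support of the measure of an mm-space. -/
def supp (X : MMSpace) : Set X := X.μ.support

/-- `Y.Dominated X` is the Lipschitz order `Y ≺ X`: there is a `1`-Lipschitz map
`supp μ_X → Y` pushing `μ_X` forward to `μ_Y`. As is customary, an mm-space is identified with
the support of its measure, so the values of `f` off `supp μ_X` (a null set) are immaterial. -/
def Dominated (Y X : MMSpace) : Prop :=
  ∃ f : X → Y, LipschitzOnWith 1 f X.supp ∧ X.μ.map f = Y.μ

/-- The distortion of `S ⊆ X × Y` (with value `0` for `S = ∅`). -/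
noncomputable def distortion {X Y : MMSpace} (S : Set (X × Y)) : ℝ≥0∞ :=
  ⨆ p ∈ S, ⨆ q ∈ S, ENNReal.ofReal |dist p.1 q.1 - dist p.2 q.2|

/-- `π` is a coupling between `μ_X` and `μ_Y`. -/
def IsCoupling {X Y : MMSpace} (π : Measure (X × Y)) : Prop :=
  π.map Prod.fst = X.μ ∧ π.map Prod.snd = Y.μ

/-- The box distance: the infimum of `max (dis S) (1 - π S)` over all couplings `π` and all Borel
sets `S`. -/
noncomputable def box (X Y : MMSpace) : ℝ≥0∞ :=
  ⨅ (π : Measure (X × Y)) (_ : IsCoupling π) (S : Set (X × Y)) (_ : MeasurableSet S),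
    max (distortion S) (1 - π S)

/-- The box distance from an mm-space to a family of mm-spaces. -/
noncomputable def boxTo (X : MMSpace) (P : Set MMSpace) : ℝ≥0∞ :=
  ⨅ Y ∈ P, box X Y

/-- mm-isomorphism: a bijective isometry between the supports preserving the measures. -/
def MMIso (X Y : MMSpace) : Prop :=
  ∃ e : X.supp ≃ᵢ Y.supp,
    (X.μ.comap ((↑) : X.supp → X)).map e = Y.μ.comap ((↑) : Y.supp → Y)

/-- A pyramid: a nonempty family of mm-spaces that is closed for the box distance, downward closed
and directed for the Lipschitz order. By `IsPyramid.mem_iff_of_mmIso` below, such a family is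
invariant under mm-isomorphism, so it is the same thing as a set of mm-isomorphism classes. -/
structure IsPyramid (P : Set MMSpace) : Prop where
  nonempty : P.Nonempty
  closed : ∀ X : MMSpace, boxTo X P = 0 → X ∈ P
  down : ∀ X Y : MMSpace, Y ∈ P → X.Dominated Y → X ∈ P
  directed : ∀ X ∈ P, ∀ Y ∈ P, ∃ Z ∈ P, X.Dominated Z ∧ Y.Dominated Z

theorem MMIso.symm {X Y : MMSpace} (h : MMIso X Y) : MMIso Y X := by
  obtain ⟨e, he⟩ := h
  refine ⟨e.symm, ?_⟩
  rw [← he, Measure.map_map e.symm.continuous.measurable e.continuous.measurable]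
  have : (e.symm : Y.supp → X.supp) ∘ e = id := by
    funext x
    simp
  rw [this, Measure.map_id]

theorem map_comap_supp (X : MMSpace) :
    (X.μ.comap ((↑) : X.supp → X)).map ((↑) : X.supp → X) = X.μ := by
  have hm : MeasurableSet X.supp := Measure.isClosed_support.measurableSet
  rw [map_comap_subtype_coe hm]
  exact Measure.restrict_eq_self_of_ae_mem Measure.support_mem_ae

theorem MMIso.dominated {X Y : MMSpace} (h : MMIso X Y) : Y.Dominated X := by
  classical
  obtain ⟨e, he⟩ := h
  have hm : MeasurableSet X.supp := Measure.isClosed_support.measurableSet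
  obtain ⟨y₀⟩ : Nonempty Y := Y.μ.nonempty_of_neZero
  let f : X → Y := fun x => if hx : x ∈ X.supp then (e ⟨x, hx⟩ : Y) else y₀
  have hf : Measurable f :=
    Measurable.dite (s := X.supp) (f := fun x => (e x : Y)) (g := fun _ => y₀)
      (continuous_subtype_val.comp e.continuous).measurable measurable_const hm
  have hcomp : f ∘ ((↑) : X.supp → X) = ((↑) : Y.supp → Y) ∘ e := by
    funext x
    simp [f]
  refine ⟨f, ?_, ?_⟩
  · intro x hx x' hx'
    have := e.edist_eq ⟨x, hx⟩ ⟨x', hx'⟩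
    simp only [f, dif_pos hx, dif_pos hx', ENNReal.coe_one, one_mul]
    exact this.le
  · rw [← X.map_comap_supp, Measure.map_map hf measurable_subtype_coe, hcomp,
      ← Measure.map_map measurable_subtype_coe e.continuous.measurable, he, Y.map_comap_supp]

theorem IsPyramid.mem_iff_of_mmIso {P : Set MMSpace} (hP : IsPyramid P) {X Y : MMSpace}
    (h : MMIso X Y) : X ∈ P ↔ Y ∈ P :=
  ⟨fun hX => hP.down Y X hX h.dominated, fun hY => hP.down X Y hY h.symm.dominated⟩

/-- Weak convergence of a sequence of pyramids. -/
def WeaklyConverges (P : ℕ → Set MMSpace) (Q : Set MMSpace) : Prop :=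
  (∀ X ∈ Q, Tendsto (fun k => boxTo X (P k)) atTop (𝓝 0)) ∧
  (∀ X, X ∉ Q → 0 < liminf (fun k => boxTo X (P k)) atTop)

/-- `IsWeight N a`: the sequence `(a_n)_{n ∈ [N]}`, `N ∈ {1, 2, …, ∞}`, lies in `𝒜₁`, that is,
`a_n > 0` and `∑ a_n = 1` (hence `a_n ≤ 1` and `N ≥ 1`). Indices start at `0`, so that `[N]` is
`{n : ℕ | n < N}`, and the sequence is extended by `0` outside `[N]`. -/
structure IsWeight (N : ℕ∞) (a : ℕ → ℝ) : Prop where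
  pos : ∀ n : ℕ, (n : ℕ∞) < N → 0 < a n
  zero : ∀ n : ℕ, N ≤ (n : ℕ∞) → a n = 0
  hasSum : HasSum a 1

/-- The direct sum `∑_{n ∈ [N]} P_n^{a_n}`: all `X` for which there are `Y_n ∈ P_n` and
`1`-Lipschitz maps `f_n : Y_n → X`, `n ∈ [N]`, with `μ_X = ∑ a_n (f_n)_* μ_{Y_n}`. The entries
with `n ∉ [N]` are arbitrary and contribute nothing, since there `a_n = 0`. -/
def directSum (N : ℕ∞) (a : ℕ → ℝ) (P : ℕ → Set MMSpace) : Set MMSpace :=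
  {X | ∃ (Y : ℕ → MMSpace) (f : ∀ n, Y n → X),
    (∀ n : ℕ, (n : ℕ∞) < N → Y n ∈ P n ∧ LipschitzOnWith 1 (f n) (Y n).supp) ∧
    X.μ = Measure.sum fun n => ENNReal.ofReal (a n) • (Y n).μ.map (f n)}

/-- The `ℓ¹`-distance between two weights (extended by `0`). -/
noncomputable def l1dist (a b : ℕ → ℝ) : ℝ := ∑' n, |a n - b n|

/-- The mm-space `(ℝ^m, ‖·‖_∞, ν)`; it is mm-isomorphic to `(B, ‖·‖_∞, ν)` for every closed
`B ⊆ ℝ^m` that contains the support of `ν`. -/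
def ofMeasure {m : ℕ} (ν : ProbabilityMeasure (Fin m → ℝ)) : MMSpace where
  carrier := Fin m → ℝ
  μ := (ν : Measure (Fin m → ℝ))

/-- The `(m, R)`-measurement of a pyramid: the Borel probability measures on `ℝ^m` (with the
sup norm) with support in the closed `R`-ball that define an mm-space in the pyramid. It is
a subset of the space of probability measures with the Prokhorov metric. -/
def measurement (P : Set MMSpace) (m : ℕ) (R : ℝ) :
    Set (LevyProkhorov (ProbabilityMeasure (Fin m → ℝ))) :=
  {ν | (ν.toMeasure : Measure (Fin m → ℝ)).support ⊆ Metric.closedBall 0 R ∧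
    ofMeasure ν.toMeasure ∈ P}

/-- The metric `ρ(P, Q) = ∑_{m ≥ 1} 2^{-m} (2m)^{-1} (d_P)_H(ℳ(P; m, m), ℳ(Q; m, m))` on
pyramids, where `(d_P)_H` is the Hausdorff distance of the Prokhorov distance. -/
noncomputable def rho (P Q : Set MMSpace) : ℝ≥0∞ :=
  ∑' i : ℕ, (2 ^ (i + 1) * (2 * ((i + 1 : ℕ) : ℝ≥0∞)))⁻¹ *
    Metric.hausdorffEDist (measurement P (i + 1) (i + 1 : ℕ))
      (measurement Q (i + 1) (i + 1 : ℕ))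

end MMSpace

/-!
An element of a direct sum `∑ P_n^{a_n}` is the same thing as a space `X` whose measure is a mixture
`μ_X = ∑ a_n ν_n` with `(X, ν_n) ∈ P_n` (`mem_directSum_iff`): replace each `Y_n` by the image of
its measure in `X`.

For the estimate of `ρ`, this says that the measurement of a direct sum consists of the mixtures of
elements of the measurements of the summands. Two mixtures whose first `M` components are close in
the Prokhorov metric are themselves close, up to the `ℓ¹`-distance of the weights and the masses
of the remaining components (`levyProkhorovEDist_mixture_le`). Summation over `m` with
`∑ 2^{-m} (2m)^{-1} ≤ 1/2` gives the claim.

For the continuity, two facts about a sequence of direct sums are needed.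

* A cluster point `X` belongs to the limit (`mem_directSum_of_mapClusterPt`). If `Y_k → X` in the
  box distance and `μ_{Y_k} = ∑ a_{nk} ν_{nk}`, disintegrating a coupling over `Y_k` transports this
  decomposition to `μ_X = ∑ a_{nk} ν'_{nk}`, with `(X, ν'_{nk})` close to `(Y_k, ν_{nk})`. Now
  `ν'_{nk} ≤ a_{nk}⁻¹ μ_X`, so for each `n` these measures converge setwise along an ultrafilter to
  a measure `ν_n` (`exists_setwise_limit`), hence also in the box distance
  (`tendsto_box_of_setwise`), and `μ_X = ∑ a_n ν_n` by dominated convergence. Weak convergence of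
  the summands gives `(X, ν_n) ∈ P_n`. For constant sequences this says that direct sums are closed.
* An element `X` of the limit, with `μ_X = ∑ a_n ν_n`, is approximated (`boxTo_directSum_le`). The
  distances from the points of a finite net map `X` to `ℝ^L`, almost isometrically up to a small
  measure. By McShane's formula this map is transported to spaces near `(X, ν_n)` in the
  approximating pyramids (`exists_lipschitz_transport`), and all of these spaces then have
  `1`-Lipschitz images in the one space `ℝ^L`, where their measures are mixed.
-/

namespace MMSpace

/-! ### Direct sums through decompositions of the measure -/

/-- The metric space underlying `X`, with its measure replaced by `ν`. -/
abbrev withMeasure (X : MMSpace) (ν : ProbabilityMeasure X) : MMSpace where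
  carrier := X
  μ := (ν : Measure X)

theorem measurableSet_supp (X : MMSpace) : MeasurableSet X.supp :=
  Measure.isClosed_support.measurableSet

theorem aemeasurable_of_lipschitzOnWith_supp {X : MMSpace} {E : Type*} [PseudoMetricSpace E]
    [MeasurableSpace E] [BorelSpace E] {f : X → E} (hf : LipschitzOnWith 1 f X.supp) :
    AEMeasurable f X.μ := by
  have h := hf.continuousOn.aemeasurable (μ := X.μ) X.measurableSet_supp
  rwa [Measure.restrict_eq_self_of_ae_mem (show ∀ᵐ x ∂X.μ, x ∈ X.supp from
    Measure.support_mem_ae)] at h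

/-- The measure of `X` as an element of the space of probability measures. -/
def prob (X : MMSpace) : ProbabilityMeasure X := ⟨X.μ, X.isProb⟩

theorem coe_prob (X : MMSpace) : (X.prob : Measure X) = X.μ := rfl

/-- The image of the measure of `X` as an element of the space of probability measures. -/
noncomputable def image (X : MMSpace) {E : Type*} [MeasurableSpace E] (f : X → E)
    (hf : AEMeasurable f X.μ) : ProbabilityMeasure E :=
  ⟨X.μ.map f, Measure.isProbabilityMeasure_map hf⟩

theorem coe_image (X : MMSpace) {E : Type*} [MeasurableSpace E] (f : X → E)
    (hf : AEMeasurable f X.μ) : (X.image f hf : Measure E) = X.μ.map f := rfl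

theorem Dominated.of_lipschitz {X : MMSpace} {Y : MMSpace} {f : X → Y}
    (hf : LipschitzOnWith 1 f X.supp) :
    (Y.withMeasure (X.image f
      (aemeasurable_of_lipschitzOnWith_supp hf))).Dominated X :=
  ⟨f, hf, rfl⟩

/-- The normal form of a direct sum: the maps into `X` may be replaced by the identity of `X`, so
that an element of the direct sum is a decomposition of the measure of `X`. -/
theorem mem_directSum_iff {N : ℕ∞} {a : ℕ → ℝ} (ha : IsWeight N a) {P : ℕ → Set MMSpace}
    (hP : ∀ n : ℕ, (n : ℕ∞) < N → IsPyramid (P n)) {X : MMSpace} :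
    X ∈ directSum N a P ↔ ∃ ν : ℕ → ProbabilityMeasure X,
      (∀ n : ℕ, (n : ℕ∞) < N → X.withMeasure (ν n) ∈ P n) ∧
      X.μ = Measure.sum fun n => ENNReal.ofReal (a n) • (ν n : Measure X) := by
  constructor
  · rintro ⟨Y, f, hYf, hX⟩
    have key : ∀ n : ℕ, ∃ ν : ProbabilityMeasure X, (n : ℕ∞) < N →
        X.withMeasure ν ∈ P n ∧ (ν : Measure X) = (Y n).μ.map (f n) := by
      intro n
      by_cases h : (n : ℕ∞) < N
      · exact ⟨(Y n).image (f n) (aemeasurable_of_lipschitzOnWith_supp (hYf n h).2), fun _ =>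
          ⟨(hP n h).down _ _ (hYf n h).1 (Dominated.of_lipschitz (hYf n h).2), rfl⟩⟩
      · exact ⟨X.prob, fun hn => absurd hn h⟩
    choose ν hν using key
    refine ⟨ν, fun n hn => (hν n hn).1, hX.trans (congrArg Measure.sum (funext fun n => ?_))⟩
    by_cases h : (n : ℕ∞) < N
    · rw [(hν n h).2]
    · simp [ha.zero n (not_lt.1 h)]
  · rintro ⟨ν, hν, hX⟩
    refine ⟨fun n => X.withMeasure (ν n), fun n => id, fun n hn => ⟨hν n hn, ?_⟩, ?_⟩
    · exact LipschitzWith.id.lipschitzOnWith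
    · simp only [Measure.map_id]
      exact hX

/-- A one-point space belongs to every pyramid. -/
theorem IsPyramid.dirac_mem {P : Set MMSpace} (hP : IsPyramid P) (X : MMSpace) (x : X)
    (δ : ProbabilityMeasure X) (hδ : (δ : Measure X) = Measure.dirac x) :
    X.withMeasure δ ∈ P := by
  obtain ⟨Y, hY⟩ := hP.nonempty
  refine hP.down _ _ hY ⟨fun _ => x, (LipschitzWith.const _).lipschitzOnWith.weaken zero_le_one, ?_⟩
  rw [Measure.map_const]
  simp [hδ]

theorem IsWeight.nonneg {N : ℕ∞} {a : ℕ → ℝ} (ha : IsWeight N a) (n : ℕ) : 0 ≤ a n := by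
  rcases lt_or_ge (n : ℕ∞) N with h | h
  · exact (ha.pos n h).le
  · exact (ha.zero n h).ge

theorem IsWeight.tsum_ofReal {N : ℕ∞} {a : ℕ → ℝ} (ha : IsWeight N a) :
    ∑' n, ENNReal.ofReal (a n) = 1 := by
  rw [← ENNReal.ofReal_tsum_of_nonneg ha.nonneg ha.hasSum.summable, ha.hasSum.tsum_eq,
    ENNReal.ofReal_one]

theorem IsWeight.sum_isProbabilityMeasure {N : ℕ∞} {a : ℕ → ℝ} (ha : IsWeight N a)
    {E : Type*} [MeasurableSpace E] (ν : ℕ → ProbabilityMeasure E) :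
    IsProbabilityMeasure (Measure.sum fun n => ENNReal.ofReal (a n) • (ν n : Measure E)) := by
  constructor
  rw [Measure.sum_apply _ MeasurableSet.univ]
  simp [ha.tsum_ofReal]

theorem smul_le_sum {E : Type*} [MeasurableSpace E] (c : ℕ → ℝ≥0∞) (ν : ℕ → Measure E) (n : ℕ) :
    c n • ν n ≤ Measure.sum fun n => c n • ν n :=
  Measure.le_sum (fun n => c n • ν n) n

theorem absolutelyContinuous_sum_smul {E : Type*} [MeasurableSpace E] {c : ℕ → ℝ≥0∞}
    (ν : ℕ → Measure E) {n : ℕ} (hc : c n ≠ 0) : ν n ≪ Measure.sum fun n => c n • ν n :=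
  (Measure.absolutelyContinuous_smul hc).trans (smul_le_sum c ν n).absolutelyContinuous

theorem directSum_nonempty {N : ℕ∞} {a : ℕ → ℝ} (ha : IsWeight N a) {P : ℕ → Set MMSpace}
    (hP : ∀ n : ℕ, (n : ℕ∞) < N → IsPyramid (P n)) : (directSum N a P).Nonempty := by
  let X : MMSpace := { carrier := PUnit, μ := Measure.dirac PUnit.unit }
  refine ⟨X, (mem_directSum_iff ha hP).2 ⟨fun _ => X.prob, fun n hn =>
    (hP n hn).dirac_mem X PUnit.unit _ rfl, ?_⟩⟩
  ext s hs
  rw [Measure.sum_apply _ hs]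
  simp [ENNReal.tsum_mul_right, ha.tsum_ofReal, coe_prob]

theorem directSum_down {N : ℕ∞} {a : ℕ → ℝ} (ha : IsWeight N a) {P : ℕ → Set MMSpace}
    (hP : ∀ n : ℕ, (n : ℕ∞) < N → IsPyramid (P n)) {X Y : MMSpace} (hY : Y ∈ directSum N a P)
    (h : X.Dominated Y) : X ∈ directSum N a P := by
  obtain ⟨ν, hν, hYμ⟩ := (mem_directSum_iff ha hP).1 hY
  obtain ⟨f, hf, hfX⟩ := h
  have hfm : AEMeasurable f Y.μ := aemeasurable_of_lipschitzOnWith_supp hf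
  refine ⟨fun n => Y.withMeasure (ν n), fun n => f, fun n hn => ⟨hν n hn, hf.mono ?_⟩, ?_⟩
  · have : (ν n : Measure Y) ≪ Y.μ := by
      rw [hYμ]
      exact absolutelyContinuous_sum_smul (c := fun n => ENNReal.ofReal (a n))
        (fun n => (ν n : Measure Y)) (by simpa using ha.pos n hn)
    exact this.support_mono
  · rw [← hfX, hYμ, Measure.map_sum (by rwa [← hYμ])]
    simp only [Measure.map_smul]

theorem directSum_directed {N : ℕ∞} {a : ℕ → ℝ} (ha : IsWeight N a) {P : ℕ → Set MMSpace}
    (hP : ∀ n : ℕ, (n : ℕ∞) < N → IsPyramid (P n)) {X Y : MMSpace} (hX : X ∈ directSum N a P)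
    (hY : Y ∈ directSum N a P) :
    ∃ Z ∈ directSum N a P, X.Dominated Z ∧ Y.Dominated Z := by
  obtain ⟨ν, hν, hXμ⟩ := (mem_directSum_iff ha hP).1 hX
  obtain ⟨ξ, hξ, hYμ⟩ := (mem_directSum_iff ha hP).1 hY
  -- The common upper bounds of the components are mapped to `X × Y` with the sup metric, where
  -- their images can be mixed.
  have key : ∀ n : ℕ, ∃ (η : ProbabilityMeasure (X × Y)), (n : ℕ∞) < N →
      ((η : Measure (X × Y)).map Prod.fst = ν n ∧ (η : Measure (X × Y)).map Prod.snd = ξ n ∧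
      ∃ Z ∈ P n, ∃ g : Z → X × Y, LipschitzOnWith 1 g Z.supp ∧ Z.μ.map g = η) := by
    intro n
    by_cases hn : (n : ℕ∞) < N
    · obtain ⟨Z, hZ, ⟨g, hg, hgX⟩, ⟨h, hh, hhY⟩⟩ := (hP n hn).directed _ (hν n hn) _ (hξ n hn)
      have hgh : LipschitzOnWith 1 (fun z => ((g z, h z) : X × Y)) Z.supp := by
        simpa using hg.prodMk hh
      have hm := aemeasurable_of_lipschitzOnWith_supp hgh
      refine ⟨Z.image _ hm, fun _ => ⟨?_, ?_, Z, hZ, _, hgh, rfl⟩⟩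
      · rw [coe_image,
          AEMeasurable.map_map_of_aemeasurable measurable_fst.aemeasurable hm]
        exact hgX
      · rw [coe_image,
          AEMeasurable.map_map_of_aemeasurable measurable_snd.aemeasurable hm]
        exact hhY
    · exact ⟨⟨X.μ.prod Y.μ, inferInstance⟩, fun h => absurd h hn⟩
  choose η hη using key
  have := ha.sum_isProbabilityMeasure η
  let Z : MMSpace :=
    { carrier := X × Y, μ := Measure.sum fun n => ENNReal.ofReal (a n) • (η n : Measure (X × Y)) }
  refine ⟨Z, (mem_directSum_iff ha hP).2 ⟨η, fun n hn => ?_, rfl⟩,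
    ⟨Prod.fst, LipschitzWith.prod_fst.lipschitzOnWith, ?_⟩,
    ⟨Prod.snd, LipschitzWith.prod_snd.lipschitzOnWith, ?_⟩⟩
  · obtain ⟨-, -, W, hW, g, hg, hgW⟩ := hη n hn
    exact (hP n hn).down _ _ hW ⟨g, hg, hgW⟩
  · rw [hXμ]
    refine (Measure.map_sum measurable_fst.aemeasurable).trans (congrArg Measure.sum ?_)
    funext n
    by_cases hn : (n : ℕ∞) < N
    · rw [Measure.map_smul, (hη n hn).1]
    · simp [ha.zero n (not_lt.1 hn)]
  · rw [hYμ]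
    refine (Measure.map_sum measurable_snd.aemeasurable).trans (congrArg Measure.sum ?_)
    funext n
    by_cases hn : (n : ℕ∞) < N
    · rw [Measure.map_smul, (hη n hn).2.1]
    · simp [ha.zero n (not_lt.1 hn)]

/-! ### Measurements of direct sums and the estimate for the distance of pyramids -/

/-- Mixtures of elements of the measurements of the summands lie in the measurement of the direct
sum. The converse is `exists_of_mem_measurement`. -/
theorem sum_mem_measurement {N : ℕ∞} {a : ℕ → ℝ} (ha : IsWeight N a) {P : ℕ → Set MMSpace}
    (hP : ∀ n : ℕ, (n : ℕ∞) < N → IsPyramid (P n)) {m : ℕ} {R : ℝ}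
    {ν : LevyProkhorov (ProbabilityMeasure (Fin m → ℝ))}
    {ξ : ℕ → ProbabilityMeasure (Fin m → ℝ)}
    (hξ : ∀ n : ℕ, (n : ℕ∞) < N → LevyProkhorov.ofMeasure (ξ n) ∈ measurement (P n) m R)
    (hν : (ν.toMeasure : Measure (Fin m → ℝ)) =
      Measure.sum fun n => ENNReal.ofReal (a n) • (ξ n : Measure (Fin m → ℝ))) :
    ν ∈ measurement (directSum N a P) m R := by
  refine ⟨Measure.support_subset_of_isClosed Metric.isClosed_closedBall ?_,
    (mem_directSum_iff ha hP).2 ⟨ξ, fun n hn => (hξ n hn).2, hν⟩⟩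
  rw [mem_ae_iff, hν, Measure.sum_apply _ Metric.isClosed_closedBall.measurableSet.compl,
    ENNReal.tsum_eq_zero]
  intro n
  by_cases h : (n : ℕ∞) < N
  · have h0 : (ξ n : Measure (Fin m → ℝ)) (Metric.closedBall 0 R)ᶜ = 0 :=
      measure_mono_null (compl_subset_compl.2 (hξ n h).1) Measure.measure_compl_support
    simp [h0]
  · simp [ha.zero n (not_lt.1 h)]

theorem exists_of_mem_measurement {N : ℕ∞} {a : ℕ → ℝ} (ha : IsWeight N a) {P : ℕ → Set MMSpace}
    (hP : ∀ n : ℕ, (n : ℕ∞) < N → IsPyramid (P n)) {m : ℕ} {R : ℝ}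
    {ν : LevyProkhorov (ProbabilityMeasure (Fin m → ℝ))}
    (hν : ν ∈ measurement (directSum N a P) m R) :
    ∃ ξ : ℕ → ProbabilityMeasure (Fin m → ℝ),
      (∀ n : ℕ, (n : ℕ∞) < N → LevyProkhorov.ofMeasure (ξ n) ∈ measurement (P n) m R) ∧
      (ν.toMeasure : Measure (Fin m → ℝ)) =
        Measure.sum fun n => ENNReal.ofReal (a n) • (ξ n : Measure (Fin m → ℝ)) := by
  obtain ⟨ξ, hξ, h⟩ : ∃ ξ : ℕ → ProbabilityMeasure (Fin m → ℝ),
      (∀ n : ℕ, (n : ℕ∞) < N → ofMeasure (ξ n) ∈ P n) ∧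
      (ν.toMeasure : Measure (Fin m → ℝ)) =
        Measure.sum fun n => ENNReal.ofReal (a n) • (ξ n : Measure (Fin m → ℝ)) :=
    (mem_directSum_iff ha hP).1 hν.2
  refine ⟨ξ, fun n hn => ⟨?_, hξ n hn⟩, h⟩
  have : (ξ n : Measure (Fin m → ℝ)) ≪ (ν.toMeasure : Measure (Fin m → ℝ)) := by
    rw [h]
    exact absolutelyContinuous_sum_smul (c := fun n => ENNReal.ofReal (a n))
      (fun n => (ξ n : Measure (Fin m → ℝ))) (by simpa using ha.pos n hn)
  exact this.support_mono.trans hν.1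

theorem IsPyramid.measurement_nonempty {P : Set MMSpace} (hP : IsPyramid P) (m : ℕ) {R : ℝ}
    (hR : 0 ≤ R) : (measurement P m R).Nonempty := by
  let δ : ProbabilityMeasure (Fin m → ℝ) := ⟨Measure.dirac 0, inferInstance⟩
  refine ⟨LevyProkhorov.ofMeasure δ, Measure.support_subset_of_isClosed
    Metric.isClosed_closedBall ?_, hP.dirac_mem (ofMeasure δ) (0 : Fin m → ℝ) δ rfl⟩
  rw [mem_ae_iff]
  change Measure.dirac 0 _ = 0
  rw [Measure.dirac_apply' _ Metric.isClosed_closedBall.measurableSet.compl]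
  simp [hR]

theorem IsWeight.summable_abs_sub {N N' : ℕ∞} {a b : ℕ → ℝ} (ha : IsWeight N a)
    (hb : IsWeight N' b) : Summable fun n => |a n - b n| :=
  (ha.hasSum.summable.sub hb.hasSum.summable).abs

theorem IsWeight.le_one {N : ℕ∞} {a : ℕ → ℝ} (ha : IsWeight N a) (n : ℕ) : a n ≤ 1 := by
  rw [← ha.hasSum.tsum_eq]
  exact ha.hasSum.summable.le_tsum n fun i _ => ha.nonneg i

theorem mul_le_mul_add_abs_sub {a b : ℝ} (ha : a ≤ 1) (hb : 0 ≤ b) {x y e : ℝ≥0∞} (hy : y ≤ 1)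
    (h : x ≤ y + e) :
    ENNReal.ofReal a * x ≤ ENNReal.ofReal b * y + (e + ENNReal.ofReal |a - b|) := by
  have hab : ENNReal.ofReal a ≤ ENNReal.ofReal b + ENNReal.ofReal |a - b| := by
    rw [← ENNReal.ofReal_add hb (abs_nonneg _)]
    exact ENNReal.ofReal_le_ofReal (by linarith [le_abs_self (a - b)])
  calc ENNReal.ofReal a * x ≤ ENNReal.ofReal a * y + ENNReal.ofReal a * e := by
        rw [← mul_add]
        gcongr
    _ ≤ (ENNReal.ofReal b + ENNReal.ofReal |a - b|) * y + 1 * e := by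
        gcongr
        exact ENNReal.ofReal_le_one.2 ha
    _ = ENNReal.ofReal b * y + ENNReal.ofReal |a - b| * y + e := by rw [add_mul, one_mul]
    _ ≤ ENNReal.ofReal b * y + ENNReal.ofReal |a - b| * 1 + e := by gcongr
    _ = ENNReal.ofReal b * y + (e + ENNReal.ofReal |a - b|) := by
        rw [mul_one, add_assoc, add_comm e]

/-- One half of the Prokhorov estimate for mixtures: the first `M` components are compared one by
one, and the masses of the remaining ones are added to the error. -/
theorem mixture_le_thickening {N N' : ℕ∞} {a b : ℕ → ℝ} (ha : IsWeight N a) (hb : IsWeight N' b)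
    {E : Type*} [MeasurableSpace E] [PseudoMetricSpace E] [BorelSpace E]
    {μ ν : ℕ → ProbabilityMeasure E} {M : ℕ} {ε : ℕ → ℝ≥0∞} {r : ℝ≥0∞} (hr : r ≠ ∞)
    (hε : ∀ n < M, levyProkhorovEDist (μ n : Measure E) (ν n : Measure E) < ε n)
    (hεr : ∑ n ∈ Finset.range M, ε n +
      ENNReal.ofReal (l1dist a b + ∑' n, a (n + M)) ≤ r)
    {B : Set E} (hB : MeasurableSet B) :
    (Measure.sum fun n => ENNReal.ofReal (a n) • (μ n : Measure E)) B ≤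
      (Measure.sum fun n => ENNReal.ofReal (b n) • (ν n : Measure E))
        (Metric.thickening r.toReal B) + r := by
  have hT : MeasurableSet (Metric.thickening r.toReal B) := Metric.isOpen_thickening.measurableSet
  rw [Measure.sum_apply _ hB, Measure.sum_apply _ hT]
  simp only [Measure.smul_apply, smul_eq_mul]
  have h1 : ∀ n ∈ Finset.range M, ENNReal.ofReal (a n) * (μ n : Measure E) B ≤
      ENNReal.ofReal (b n) * (ν n : Measure E) (Metric.thickening r.toReal B) +
        (ε n + ENNReal.ofReal |a n - b n|) := by
    intro n hn
    have hεn : ε n ≤ r := ((Finset.single_le_sum (f := ε) (fun _ _ => zero_le) hn).trans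
      le_self_add).trans hεr
    refine mul_le_mul_add_abs_sub (ha.le_one n) (hb.nonneg n) prob_le_one ?_
    refine (left_measure_le_of_levyProkhorovEDist_lt (hε n (Finset.mem_range.1 hn)) hB).trans ?_
    gcongr
  have htail : Summable fun n => a (n + M) := (summable_nat_add_iff M).2 ha.hasSum.summable
  have hl1 := ha.summable_abs_sub hb
  calc ∑' n, ENNReal.ofReal (a n) * (μ n : Measure E) B
      = ∑ n ∈ Finset.range M, ENNReal.ofReal (a n) * (μ n : Measure E) B +
        ∑' n, ENNReal.ofReal (a (n + M)) * (μ (n + M) : Measure E) B :=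
        (ENNReal.summable.sum_add_tsum_nat_add' (k := M)).symm
    _ ≤ ∑ n ∈ Finset.range M, (ENNReal.ofReal (b n) *
          (ν n : Measure E) (Metric.thickening r.toReal B) +
          (ε n + ENNReal.ofReal |a n - b n|)) + ∑' n, ENNReal.ofReal (a (n + M)) * 1 := by
        gcongr with n hn n
        · exact h1 n hn
        · exact prob_le_one
    _ = ∑ n ∈ Finset.range M, ENNReal.ofReal (b n) *
          (ν n : Measure E) (Metric.thickening r.toReal B) +
          (∑ n ∈ Finset.range M, ε n + (∑ n ∈ Finset.range M, ENNReal.ofReal |a n - b n| +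
            ENNReal.ofReal (∑' n, a (n + M)))) := by
        rw [Finset.sum_add_distrib, Finset.sum_add_distrib,
          ENNReal.ofReal_tsum_of_nonneg (fun n => ha.nonneg _) htail]
        simp only [mul_one, add_assoc]
    _ ≤ ∑' n, ENNReal.ofReal (b n) * (ν n : Measure E) (Metric.thickening r.toReal B) + r := by
        refine add_le_add (ENNReal.sum_le_tsum _) (le_trans (add_le_add le_rfl ?_) hεr)
        rw [ENNReal.ofReal_add
          (show 0 ≤ l1dist a b from tsum_nonneg fun _ => abs_nonneg _)
          (tsum_nonneg fun n => ha.nonneg _)]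
        gcongr
        rw [l1dist, ENNReal.ofReal_tsum_of_nonneg (fun n => abs_nonneg _) hl1]
        exact ENNReal.sum_le_tsum _

theorem l1dist_comm (a b : ℕ → ℝ) : l1dist a b = l1dist b a := by
  simp only [l1dist, abs_sub_comm]

theorem levyProkhorovEDist_mixture_le {N N' : ℕ∞} {a b : ℕ → ℝ} (ha : IsWeight N a)
    (hb : IsWeight N' b) {E : Type*} [MeasurableSpace E] [PseudoMetricSpace E] [BorelSpace E]
    {μ ν : ℕ → ProbabilityMeasure E} {M : ℕ} {ε : ℕ → ℝ≥0∞}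
    (hε : ∀ n < M, levyProkhorovEDist (μ n : Measure E) (ν n : Measure E) < ε n) :
    levyProkhorovEDist (Measure.sum fun n => ENNReal.ofReal (a n) • (μ n : Measure E))
      (Measure.sum fun n => ENNReal.ofReal (b n) • (ν n : Measure E)) ≤
      ∑ n ∈ Finset.range M, ε n +
        ENNReal.ofReal (l1dist a b + ∑' n, a (n + M) + ∑' n, b (n + M)) := by
  have hA : 0 ≤ ∑' n, a (n + M) := tsum_nonneg fun n => ha.nonneg _
  have hB : 0 ≤ ∑' n, b (n + M) := tsum_nonneg fun n => hb.nonneg _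
  refine levyProkhorovEDist_le_of_forall _ _ _ fun r B hr hr' hBm => ⟨?_, ?_⟩
  · refine mixture_le_thickening ha hb hr'.ne hε (le_trans ?_ hr.le) hBm
    exact add_le_add le_rfl (ENNReal.ofReal_le_ofReal (by linarith))
  · refine mixture_le_thickening hb ha hr'.ne (M := M) (ε := ε) (fun n hn => ?_)
      (le_trans ?_ hr.le) hBm
    · rw [levyProkhorovEDist_comm]
      exact hε n hn
    · rw [l1dist_comm b a]
      exact add_le_add le_rfl (ENNReal.ofReal_le_ofReal (by linarith))

/-- Every element of the measurement of one direct sum is close to the measurement of the other: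
replace each of the first `M` components by a nearly optimal one. -/
theorem exists_edist_le_of_mem_measurement_directSum {N N' : ℕ∞} {a b : ℕ → ℝ}
    {P Q : ℕ → Set MMSpace} (ha : IsWeight N a) (hb : IsWeight N' b)
    (hP : ∀ n : ℕ, (n : ℕ∞) < N → IsPyramid (P n))
    (hQ : ∀ n : ℕ, (n : ℕ∞) < N' → IsPyramid (Q n)) {M : ℕ} (hM : (M : ℕ∞) ≤ min N N')
    (m : ℕ) {R : ℝ} (hR : 0 ≤ R) {ε : ℕ → ℝ≥0∞}
    (hε : ∀ n < M, Metric.hausdorffEDist (measurement (P n) m R) (measurement (Q n) m R) < ε n)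
    {ν : LevyProkhorov (ProbabilityMeasure (Fin m → ℝ))}
    (hν : ν ∈ measurement (directSum N a P) m R) :
    ∃ ν' ∈ measurement (directSum N' b Q) m R, edist ν ν' ≤ ∑ n ∈ Finset.range M, ε n +
        ENNReal.ofReal (l1dist a b + ∑' n, a (n + M) + ∑' n, b (n + M)) := by
  obtain ⟨ξ, hξ, hνξ⟩ := exists_of_mem_measurement ha hP hν
  have key : ∀ n : ℕ, ∃ ζ : ProbabilityMeasure (Fin m → ℝ),
      ((n : ℕ∞) < N' → LevyProkhorov.ofMeasure ζ ∈ measurement (Q n) m R) ∧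
      (n < M → levyProkhorovEDist (ξ n : Measure (Fin m → ℝ)) (ζ : Measure (Fin m → ℝ)) < ε n) := by
    intro n
    by_cases hn : n < M
    · have hnN : (n : ℕ∞) < N := lt_of_lt_of_le (by exact_mod_cast hn) (le_min_iff.1 hM).1
      obtain ⟨ζ, hζ, h⟩ := Metric.exists_edist_lt_of_hausdorffEDist_lt (hξ n hnN) (hε n hn)
      exact ⟨ζ.toMeasure, fun _ => hζ, fun _ => h⟩
    · by_cases hn' : (n : ℕ∞) < N'
      · obtain ⟨ζ, hζ⟩ := (hQ n hn').measurement_nonempty m hR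
        exact ⟨ζ.toMeasure, fun _ => hζ, fun h => absurd h hn⟩
      · exact ⟨ξ n, fun h => absurd h hn', fun h => absurd h hn⟩
  choose ζ hζ hξζ using key
  let ν' : ProbabilityMeasure (Fin m → ℝ) := ⟨_, hb.sum_isProbabilityMeasure ζ⟩
  refine ⟨LevyProkhorov.ofMeasure ν', sum_mem_measurement hb hQ hζ rfl, ?_⟩
  rw [LevyProkhorov.edist_probabilityMeasure_def, hνξ]
  exact levyProkhorovEDist_mixture_le ha hb hξζ

theorem hausdorffEDist_measurement_directSum_le {N N' : ℕ∞} {a b : ℕ → ℝ}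
    {P Q : ℕ → Set MMSpace} (ha : IsWeight N a) (hb : IsWeight N' b)
    (hP : ∀ n : ℕ, (n : ℕ∞) < N → IsPyramid (P n))
    (hQ : ∀ n : ℕ, (n : ℕ∞) < N' → IsPyramid (Q n)) {M : ℕ} (hM : (M : ℕ∞) ≤ min N N')
    (m : ℕ) {R : ℝ} (hR : 0 ≤ R) :
    Metric.hausdorffEDist (measurement (directSum N a P) m R)
      (measurement (directSum N' b Q) m R) ≤
      ∑ n ∈ Finset.range M,
        Metric.hausdorffEDist (measurement (P n) m R) (measurement (Q n) m R) +
        ENNReal.ofReal (l1dist a b + ∑' n, a (n + M) + ∑' n, b (n + M)) := by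
  set d := fun n => Metric.hausdorffEDist (measurement (P n) m R) (measurement (Q n) m R) with hd
  by_cases htop : ∑ n ∈ Finset.range M, d n = ∞
  · rw [htop]
    simp
  refine ENNReal.le_of_forall_pos_le_add fun δ hδ _ => ?_
  have hlt : ∀ n < M, d n < d n + δ / M := by
    intro n hn
    refine ENNReal.lt_add_right ?_ ?_
    · exact fun h => htop (ENNReal.sum_eq_top.2 ⟨n, Finset.mem_range.2 hn, h⟩)
    · exact (ENNReal.div_pos (by simpa using hδ.ne') (by simp)).ne'
  have hsum : ∑ n ∈ Finset.range M, (d n + δ / M) ≤ ∑ n ∈ Finset.range M, d n + δ := by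
    rw [Finset.sum_add_distrib, Finset.sum_const, Finset.card_range, nsmul_eq_mul]
    gcongr
    exact ENNReal.mul_div_le
  refine le_trans (b := ∑ n ∈ Finset.range M, (d n + δ / M) +
    ENNReal.ofReal (l1dist a b + ∑' n, a (n + M) + ∑' n, b (n + M))) ?_ ?_
  · refine Metric.hausdorffEDist_le_of_mem_edist (fun ν hν => ?_) (fun ν hν => ?_)
    · exact exists_edist_le_of_mem_measurement_directSum ha hb hP hQ hM m hR hlt hν
    · rw [l1dist_comm, add_right_comm (l1dist b a)]
      refine exists_edist_le_of_mem_measurement_directSum hb ha hQ hP (by rwa [min_comm]) m hR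
        (fun n hn => ?_) hν
      rw [Metric.hausdorffEDist_comm]
      exact hlt n hn
  · exact (add_le_add hsum le_rfl).trans_eq (add_right_comm _ _ _)

theorem tsum_rho_weights_le :
    ∑' i : ℕ, (2 ^ (i + 1) * (2 * ((i + 1 : ℕ) : ℝ≥0∞)))⁻¹ ≤ 2⁻¹ := by
  have h : ∀ i : ℕ, (2 ^ (i + 1) * (2 * ((i + 1 : ℕ) : ℝ≥0∞)))⁻¹ ≤ (2 ^ (i + 1))⁻¹ * 2⁻¹ := by
    intro i
    rw [← ENNReal.mul_inv (by simp) (by simp)]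
    refine ENNReal.inv_le_inv.2 ?_
    gcongr
    refine le_mul_of_one_le_right zero_le ?_
    exact_mod_cast Nat.succ_le_succ (Nat.zero_le i)
  refine (ENNReal.tsum_le_tsum h).trans ?_
  rw [ENNReal.tsum_mul_right]
  have : ∑' i : ℕ, ((2 : ℝ≥0∞) ^ (i + 1))⁻¹ = 1 := by
    have h := ENNReal.tsum_geometric_add_one (2⁻¹ : ℝ≥0∞)
    rw [ENNReal.one_sub_inv_two, inv_inv, ENNReal.inv_mul_cancel (by simp) (by simp)] at h
    simpa [ENNReal.inv_pow] using h
  rw [this, one_mul]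

theorem rho_directSum_le {N N' : ℕ∞} {a b : ℕ → ℝ} {P Q : ℕ → Set MMSpace} (ha : IsWeight N a)
    (hb : IsWeight N' b) (hP : ∀ n : ℕ, (n : ℕ∞) < N → IsPyramid (P n))
    (hQ : ∀ n : ℕ, (n : ℕ∞) < N' → IsPyramid (Q n)) {M : ℕ} (hM : (M : ℕ∞) ≤ min N N') :
    rho (directSum N a P) (directSum N' b Q) ≤
      ∑ n ∈ Finset.range M, rho (P n) (Q n) +
        ENNReal.ofReal (1 / 2 * l1dist a b + 1 / 2 * ∑' n, a (n + M) +
          1 / 2 * ∑' n, b (n + M)) := by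
  set T := l1dist a b + ∑' n, a (n + M) + ∑' n, b (n + M) with hT
  have hT2 : ENNReal.ofReal (1 / 2 * l1dist a b + 1 / 2 * ∑' n, a (n + M) +
      1 / 2 * ∑' n, b (n + M)) = 2⁻¹ * ENNReal.ofReal T := by
    rw [show 1 / 2 * l1dist a b + 1 / 2 * ∑' n, a (n + M) + 1 / 2 * ∑' n, b (n + M) = 2⁻¹ * T by
      rw [hT]; ring, ENNReal.ofReal_mul (by norm_num), ENNReal.ofReal_inv_of_pos (by norm_num)]
    simp
  rw [hT2]
  unfold rho
  calc _ ≤ ∑' i : ℕ, (2 ^ (i + 1) * (2 * ((i + 1 : ℕ) : ℝ≥0∞)))⁻¹ *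
          (∑ n ∈ Finset.range M, Metric.hausdorffEDist (measurement (P n) (i + 1) (i + 1 : ℕ))
            (measurement (Q n) (i + 1) (i + 1 : ℕ)) + ENNReal.ofReal T) := by
        gcongr with i
        exact hausdorffEDist_measurement_directSum_le ha hb hP hQ hM _ (Nat.cast_nonneg _)
    _ = ∑ n ∈ Finset.range M, ∑' i : ℕ, (2 ^ (i + 1) * (2 * ((i + 1 : ℕ) : ℝ≥0∞)))⁻¹ *
          Metric.hausdorffEDist (measurement (P n) (i + 1) (i + 1 : ℕ))
            (measurement (Q n) (i + 1) (i + 1 : ℕ)) +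
        (∑' i : ℕ, (2 ^ (i + 1) * (2 * ((i + 1 : ℕ) : ℝ≥0∞)))⁻¹) * ENNReal.ofReal T := by
        simp only [mul_add, Finset.mul_sum]
        rw [ENNReal.tsum_add, ENNReal.tsum_mul_right,
          Summable.tsum_finsetSum fun n _ => ENNReal.summable]
    _ ≤ _ := by
        gcongr
        exact tsum_rho_weights_le

/-! ### The box distance -/

instance (X : MMSpace) : Nonempty X := X.μ.nonempty_of_neZero

theorem IsCoupling.isProbabilityMeasure {X Y : MMSpace} {π : Measure (X × Y)}
    (hπ : IsCoupling (X := X) (Y := Y) π) : IsProbabilityMeasure π := by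
  constructor
  rw [← preimage_univ (f := Prod.fst), ← Measure.map_apply measurable_fst MeasurableSet.univ, hπ.1,
    measure_univ]

theorem box_le {X Y : MMSpace} {π : Measure (X × Y)} (hπ : IsCoupling (X := X) (Y := Y) π)
    {S : Set (X × Y)} (hS : MeasurableSet S) :
    box X Y ≤ max (distortion (X := X) (Y := Y) S) (1 - π S) :=
  iInf₂_le_of_le π hπ (iInf₂_le S hS)

theorem box_le_of_measure_compl_le {X Y : MMSpace} {π : Measure (X × Y)}
    (hπ : IsCoupling (X := X) (Y := Y) π) {S : Set (X × Y)} (hS : MeasurableSet S) {ε : ℝ≥0∞}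
    (hd : distortion (X := X) (Y := Y) S ≤ ε) (h : π Sᶜ ≤ ε) : box X Y ≤ ε := by
  have := hπ.isProbabilityMeasure
  refine (box_le hπ hS).trans (max_le hd ?_)
  rwa [← prob_compl_eq_one_sub hS]

theorem exists_coupling_of_box_lt {X Y : MMSpace} {ε : ℝ≥0∞} (h : box X Y < ε) :
    ∃ π : Measure (X × Y), IsCoupling (X := X) (Y := Y) π ∧ ∃ S : Set (X × Y), MeasurableSet S ∧
      distortion (X := X) (Y := Y) S ≤ ε ∧ π Sᶜ ≤ ε := by
  simp only [box, iInf_lt_iff, max_lt_iff] at h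
  obtain ⟨π, hπ, S, hS, h1, h2⟩ := h
  have := hπ.isProbabilityMeasure
  exact ⟨π, hπ, S, hS, h1.le, by rw [prob_compl_eq_one_sub hS]; exact h2.le⟩

theorem ofReal_le_distortion {X Y : MMSpace} {S : Set (X × Y)} {p q : X × Y} (hp : p ∈ S)
    (hq : q ∈ S) :
    ENNReal.ofReal |dist p.1 q.1 - dist p.2 q.2| ≤ distortion (X := X) (Y := Y) S :=
  le_iSup₂_of_le p hp (le_iSup₂_of_le q hq le_rfl)

theorem distortion_le {X Y : MMSpace} {S : Set (X × Y)} {ε : ℝ≥0∞}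
    (h : ∀ p ∈ S, ∀ q ∈ S, ENNReal.ofReal |dist p.1 q.1 - dist p.2 q.2| ≤ ε) :
    distortion (X := X) (Y := Y) S ≤ ε :=
  iSup₂_le fun p hp => iSup₂_le fun q hq => h p hp q hq

theorem distortion_closure_le {X Y : MMSpace} (S : Set (X × Y)) :
    distortion (X := X) (Y := Y) (closure S) ≤ distortion (X := X) (Y := Y) S := by
  have hcl : IsClosed {z : (X × Y) × (X × Y) |
      ENNReal.ofReal |dist z.1.1 z.2.1 - dist z.1.2 z.2.2| ≤ distortion (X := X) (Y := Y) S} :=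
    isClosed_le (ENNReal.continuous_ofReal.comp (by fun_prop)) continuous_const
  have hsub : closure (S ×ˢ S) ⊆ _ := closure_minimal
    (fun z (hz : z ∈ S ×ˢ S) => ofReal_le_distortion hz.1 hz.2) hcl
  rw [closure_prod_eq] at hsub
  exact distortion_le fun p hp q hq => hsub (show (p, q) ∈ _ from ⟨hp, hq⟩)

/-- It suffices to couple a part of the masses: a measure whose marginals are at most `μ_X` and
`μ_Y` is completed to a coupling by a multiple of the product of the missing masses. -/
theorem box_le_of_subcoupling {X Y : MMSpace} {θ : Measure (X × Y)}
    (h1 : θ.map Prod.fst ≤ X.μ) (h2 : θ.map Prod.snd ≤ Y.μ) {S : Set (X × Y)}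
    (hS : MeasurableSet S) :
    box X Y ≤ max (distortion (X := X) (Y := Y) S) (1 - θ S) := by
  have hf1 : IsFiniteMeasure (θ.map Prod.fst) := isFiniteMeasure_of_le _ h1
  have hf2 : IsFiniteMeasure (θ.map Prod.snd) := isFiniteMeasure_of_le _ h2
  have hu1 : θ.map Prod.fst univ = θ univ := by
    rw [Measure.map_apply measurable_fst MeasurableSet.univ, preimage_univ]
  have hu2 : θ.map Prod.snd univ = θ univ := by
    rw [Measure.map_apply measurable_snd MeasurableSet.univ, preimage_univ]
  set t := θ univ with ht
  set ρ₁ := X.μ - θ.map Prod.fst with hρ₁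
  set ρ₂ := Y.μ - θ.map Prod.snd with hρ₂
  have hr1 : ρ₁ univ = 1 - t := by
    rw [hρ₁, Measure.sub_apply MeasurableSet.univ h1, hu1, measure_univ]
  have hr2 : ρ₂ univ = 1 - t := by
    rw [hρ₂, Measure.sub_apply MeasurableSet.univ h2, hu2, measure_univ]
  have hs1 : ρ₁ + θ.map Prod.fst = X.μ := Measure.sub_add_cancel_of_le h1
  have hs2 : ρ₂ + θ.map Prod.snd = Y.μ := Measure.sub_add_cancel_of_le h2
  have hcancel : ∀ {E : Type} [MeasurableSpace E] (ρ : Measure E), ρ univ = 1 - t →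
      (1 - t)⁻¹ • (1 - t) • ρ = ρ := by
    intro E _ ρ hρ
    rw [smul_smul]
    by_cases h0 : 1 - t = 0
    · rw [h0, Measure.measure_univ_eq_zero] at hρ
      simp [hρ]
    · rw [ENNReal.inv_mul_cancel h0 (by simp), one_smul]
  -- If `t = 1`, then `ρ₁ = ρ₂ = 0` and the factor `(1 - t)⁻¹ = ∞` is harmless.
  let π := θ + (1 - t)⁻¹ • ρ₁.prod ρ₂
  have hπ : IsCoupling (X := X) (Y := Y) π := by
    constructor
    · rw [Measure.map_add _ _ measurable_fst, Measure.map_smul, Measure.map_fst_prod, hr2,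
        hcancel ρ₁ hr1, add_comm, hs1]
    · rw [Measure.map_add _ _ measurable_snd, Measure.map_smul, Measure.map_snd_prod, hr1,
        hcancel ρ₂ hr2, add_comm, hs2]
  refine (box_le hπ hS).trans (max_le_max le_rfl (tsub_le_tsub_left ?_ _))
  exact (Measure.le_add_right le_rfl : θ ≤ π) S

/-- The triangle inequality for the box distance. The couplings are glued along `Y`; passing to the
closure of the composition of the two relations makes it measurable. -/
theorem box_le_add {X Y Z : MMSpace} {ε δ : ℝ≥0∞} (h : box X Y < ε) (h' : box Y Z < δ) :
    box X Z ≤ ε + δ := by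
  obtain ⟨π, hπ, S, hS, hSd, hSm⟩ := exists_coupling_of_box_lt h
  obtain ⟨ξ, hξ, T, hT, hTd, hTm⟩ := exists_coupling_of_box_lt h'
  have := hπ.isProbabilityMeasure
  have := hξ.isProbabilityMeasure
  let τ : Measure ((X × Y) × Z) := π.compProd (ξ.condKernel.comap Prod.snd measurable_snd)
  have hτ1 : τ.map Prod.fst = π := Measure.fst_compProd π _
  have hτ2 : τ.map (fun p => (p.1.2, p.2)) = ξ := by
    ext s hs
    have hξ' : ξ.fst = π.map Prod.snd := hξ.1.trans hπ.2.symm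
    have hm : Measurable fun p : (X × Y) × Z => (p.1.2, p.2) := by fun_prop
    rw [Measure.map_apply hm hs, Measure.compProd_apply (hm hs)]
    conv_rhs => rw [← ξ.disintegrate ξ.condKernel]
    rw [Measure.compProd_apply hs, hξ',
      lintegral_map (ProbabilityTheory.Kernel.measurable_kernel_prodMk_left hs) measurable_snd]
    rfl
  have hm : Measurable fun p : (X × Y) × Z => (p.1.1, p.2) := by fun_prop
  have hm' : Measurable fun p : (X × Y) × Z => (p.1.2, p.2) := by fun_prop
  let R : Set (X × Z) := {p | ∃ y, (p.1, y) ∈ S ∧ (y, p.2) ∈ T}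
  refine box_le_of_measure_compl_le (π := τ.map fun p => (p.1.1, p.2)) (S := closure R)
    ⟨?_, ?_⟩ isClosed_closure.measurableSet ((distortion_closure_le R).trans ?_) ?_
  · rw [Measure.map_map measurable_fst hm, ← hπ.1, ← hτ1,
      Measure.map_map measurable_fst measurable_fst]
    rfl
  · rw [Measure.map_map measurable_snd hm, ← hξ.2, ← hτ2,
      Measure.map_map measurable_snd hm']
    rfl
  · refine distortion_le ?_
    rintro ⟨x, z⟩ ⟨y, hxy, hyz⟩ ⟨x', z'⟩ ⟨y', hxy', hyz'⟩
    refine le_trans ?_ (add_le_add ((ofReal_le_distortion hxy hxy').trans hSd)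
      ((ofReal_le_distortion hyz hyz').trans hTd))
    rw [← ENNReal.ofReal_add (abs_nonneg _) (abs_nonneg _)]
    exact ENNReal.ofReal_le_ofReal (abs_sub_le _ _ _)
  · rw [Measure.map_apply hm isClosed_closure.measurableSet.compl]
    have hsub : (fun p : (X × Y) × Z => (p.1.1, p.2)) ⁻¹' (closure R)ᶜ ⊆
        Prod.fst ⁻¹' Sᶜ ∪ (fun p : (X × Y) × Z => (p.1.2, p.2)) ⁻¹' Tᶜ := by
      rintro ⟨⟨x, y⟩, z⟩ hp
      by_contra hcon
      simp only [mem_union, mem_preimage, mem_compl_iff, not_or, not_not] at hcon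
      exact hp (subset_closure ⟨y, hcon.1, hcon.2⟩)
    refine (measure_mono hsub).trans ((measure_union_le _ _).trans (add_le_add ?_ ?_))
    · rwa [← Measure.map_apply measurable_fst hS.compl, hτ1]
    · rwa [← Measure.map_apply hm' hT.compl, hτ2]

/-- A decomposition of the measure of `Y` is transported to a decomposition of the measure of a
space `X` near `Y` by disintegrating a coupling over `Y`. -/
theorem exists_decomposition_of_box_lt {X Y : MMSpace} {ε : ℝ≥0∞} (h : box X Y < ε) {N : ℕ∞}
    {a : ℕ → ℝ} (ha : IsWeight N a) {ν : ℕ → ProbabilityMeasure Y}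
    (hν : Y.μ = Measure.sum fun n => ENNReal.ofReal (a n) • (ν n : Measure Y)) :
    ∃ ν' : ℕ → ProbabilityMeasure X,
      X.μ = Measure.sum (fun n => ENNReal.ofReal (a n) • (ν' n : Measure X)) ∧
      ∀ n : ℕ, (n : ℕ∞) < N →
        box (X.withMeasure (ν' n)) (Y.withMeasure (ν n)) ≤ ε / ENNReal.ofReal (a n) := by
  obtain ⟨π, hπ, S, hS, hSd, hSm⟩ := exists_coupling_of_box_lt h
  have := hπ.isProbabilityMeasure
  set π' : Measure (Y × X) := π.map Prod.swap with hπ'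
  have : IsProbabilityMeasure π' := Measure.isProbabilityMeasure_map measurable_swap.aemeasurable
  have hfst : π'.fst = Y.μ := by
    rw [← hπ.2, Measure.fst, hπ', Measure.map_map measurable_fst measurable_swap]
    rfl
  have hsnd : π'.snd = X.μ := by
    rw [← hπ.1, Measure.snd, hπ', Measure.map_map measurable_snd measurable_swap]
    rfl
  let θ : ℕ → Measure (Y × X) := fun n => (ν n : Measure Y).compProd π'.condKernel
  have hθ : ∀ n, IsProbabilityMeasure (θ n) := fun n => by dsimp only [θ]; infer_instance
  have hsum : π' = Measure.sum fun n => ENNReal.ofReal (a n) • θ n := by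
    conv_lhs => rw [← π'.disintegrate π'.condKernel, hfst, hν]
    rw [Measure.compProd_sum_left]
    simp only [Measure.compProd_smul_left, θ]
  let ν' : ℕ → ProbabilityMeasure X := fun n => ⟨(θ n).snd, inferInstance⟩
  refine ⟨ν', ?_, fun n hn => ?_⟩
  · rw [← hsnd]
    conv_lhs => rw [hsum]
    rw [Measure.snd, Measure.map_sum measurable_snd.aemeasurable]
    simp only [Measure.map_smul]
    rfl
  · have han : ENNReal.ofReal (a n) ≠ 0 := by simpa using ha.pos n hn
    have hle1 : ENNReal.ofReal (a n) ≤ 1 := ENNReal.ofReal_le_one.2 (ha.le_one n)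
    refine box_le_of_measure_compl_le (X := X.withMeasure (ν' n)) (Y := Y.withMeasure (ν n))
      (π := (θ n).map Prod.swap) (S := S) ⟨?_, ?_⟩ hS (hSd.trans ?_) ?_
    · rw [Measure.map_map measurable_fst measurable_swap]
      rfl
    · rw [Measure.map_map measurable_snd measurable_swap]
      exact Measure.fst_compProd _ _
    · rw [ENNReal.le_div_iff_mul_le (Or.inl han) (Or.inl ENNReal.ofReal_ne_top)]
      exact mul_le_of_le_one_right zero_le hle1
    · rw [ENNReal.le_div_iff_mul_le (Or.inl han) (Or.inl ENNReal.ofReal_ne_top), mul_comm,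
        Measure.map_apply measurable_swap hS.compl]
      refine le_trans ?_ hSm
      have h3 := (smul_le_sum (fun n => ENNReal.ofReal (a n)) θ n) (Prod.swap ⁻¹' Sᶜ)
      rw [← hsum, hπ', Measure.map_apply measurable_swap (measurable_swap hS.compl)] at h3
      exact h3

theorem min_le_inv_max_mul {p q : ℝ≥0∞} (hp : p ≠ ∞) (hq : q ≠ ∞) :
    min p q ≤ (max p q)⁻¹ * (p * q) := by
  rcases eq_or_ne (max p q) 0 with h | h
  · have : p = 0 := le_antisymm ((le_max_left p q).trans h.le) zero_le
    simp [this]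
  · rw [← max_mul_min p q, ← mul_assoc, ENNReal.inv_mul_cancel h (max_lt hp.lt_top hq.lt_top).ne,
      one_mul]

theorem inv_max_mul_le_one (p q : ℝ≥0∞) : (max p q)⁻¹ * q ≤ 1 := by
  refine (mul_le_mul_right (le_max_right p q) _).trans ?_
  exact ENNReal.inv_mul_le_one _

/-- Setwise convergence of measures on a fixed space implies convergence in the box distance: cut
most of the space into finitely many small pieces and couple within the pieces. -/
theorem tendsto_box_of_setwise {X : MMSpace} {κ : Type*} {l : Filter κ}
    {ν : κ → ProbabilityMeasure X} {ξ : ProbabilityMeasure X}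
    (h : ∀ A, MeasurableSet A →
      Tendsto (fun k => (ν k : Measure X) A) l (𝓝 ((ξ : Measure X) A))) :
    Tendsto (fun k => box (X.withMeasure ξ) (X.withMeasure (ν k))) l (𝓝 0) := by
  rw [ENNReal.tendsto_nhds_zero]
  intro ε' hε'
  obtain ⟨ε, hε, hεε'⟩ : ∃ ε : ℝ, 0 < ε ∧ ENNReal.ofReal ε ≤ ε' := by
    obtain ⟨r, hr, hr'⟩ := ENNReal.lt_iff_exists_nnreal_btwn.1 hε'
    exact ⟨r, by exact_mod_cast hr, by simpa using hr'.le⟩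
  obtain ⟨A, hAm, hAb, hAd, hAu, hAdisj⟩ :=
    SeparableSpace.exists_measurable_partition_diam_le (Ω := X) (half_pos hε)
  have hsum1 : ∑' i, (ξ : Measure X) (A i) = 1 := by
    rw [← measure_iUnion hAdisj hAm, hAu, measure_univ]
  obtain ⟨L, hL⟩ : ∃ L, 1 - ∑ i ∈ Finset.range L, (ξ : Measure X) (A i) < ENNReal.ofReal ε := by
    have ht : Tendsto (fun L => 1 - ∑ i ∈ Finset.range L, (ξ : Measure X) (A i)) atTop
        (𝓝 (1 - 1)) := by
      refine ENNReal.Tendsto.sub tendsto_const_nhds ?_ (Or.inl (by simp))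
      rw [← hsum1]
      exact ENNReal.tendsto_nat_tsum _
    rw [tsub_self] at ht
    exact (ht.eventually_lt_const (by simpa using hε)).exists
  have hev : ∀ᶠ k in l, 1 - ∑ i ∈ Finset.range L,
      min ((ξ : Measure X) (A i)) ((ν k : Measure X) (A i)) < ENNReal.ofReal ε := by
    have ht : Tendsto (fun k => 1 - ∑ i ∈ Finset.range L,
        min ((ξ : Measure X) (A i)) ((ν k : Measure X) (A i))) l
        (𝓝 (1 - ∑ i ∈ Finset.range L, min ((ξ : Measure X) (A i)) ((ξ : Measure X) (A i)))) :=
      ENNReal.Tendsto.sub tendsto_const_nhds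
        (tendsto_finsetSum _ fun i _ => tendsto_const_nhds.min (h _ (hAm i))) (Or.inl (by simp))
    simp only [min_self] at ht
    exact ht.eventually_lt_const hL
  filter_upwards [hev] with k hk
  refine le_trans ?_ hεε'
  -- With `p, q` the two masses of `A i`, this is the factor `min p q / (p q)`, so that the product
  -- on `A i × A i` gets the mass `min p q`.
  let c : ℕ → ℝ≥0∞ := fun i => (max ((ξ : Measure X) (A i)) ((ν k : Measure X) (A i)))⁻¹
  let θ : Measure (X × X) := ∑ i ∈ Finset.range L,
    c i • ((ξ : Measure X).restrict (A i)).prod ((ν k : Measure X).restrict (A i))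
  let S : Set (X × X) := ⋃ i ∈ Finset.range L, A i ×ˢ A i
  have hS : MeasurableSet S :=
    Finset.measurableSet_biUnion _ fun i _ => (hAm i).prod (hAm i)
  have hrestr : ∀ ρ : Measure X, ∑ i ∈ Finset.range L, ρ.restrict (A i) ≤ ρ := by
    intro ρ
    calc ∑ i ∈ Finset.range L, ρ.restrict (A i) ≤ Measure.sum fun i => ρ.restrict (A i) := by
          refine Measure.le_iff.2 fun s hs => ?_
          rw [Measure.finsetSum_apply, Measure.sum_apply _ hs]
          exact ENNReal.sum_le_tsum _
      _ = ρ := by rw [← Measure.restrict_iUnion hAdisj hAm, hAu, Measure.restrict_univ]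
  refine (box_le_of_subcoupling (X := X.withMeasure ξ) (Y := X.withMeasure (ν k)) (θ := θ)
    (S := S) ?_ ?_ hS).trans (max_le ?_ ?_)
  · refine le_trans ?_ (hrestr _)
    rw [← Measure.mapₗ_apply_of_measurable measurable_fst, map_sum]
    refine Finset.sum_le_sum fun i _ => ?_
    rw [Measure.mapₗ_apply_of_measurable measurable_fst, Measure.map_smul, Measure.map_fst_prod,
      Measure.restrict_apply_univ, smul_smul]
    refine Measure.le_iff.2 fun s _ => ?_
    exact mul_le_of_le_one_left zero_le (inv_max_mul_le_one _ _)
  · refine le_trans ?_ (hrestr _)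
    rw [← Measure.mapₗ_apply_of_measurable measurable_snd, map_sum]
    refine Finset.sum_le_sum fun i _ => ?_
    rw [Measure.mapₗ_apply_of_measurable measurable_snd, Measure.map_smul, Measure.map_snd_prod,
      Measure.restrict_apply_univ, smul_smul]
    refine Measure.le_iff.2 fun s _ => ?_
    refine mul_le_of_le_one_left zero_le ?_
    dsimp only [c]
    rw [max_comm]
    exact inv_max_mul_le_one _ _
  · refine distortion_le ?_
    rintro ⟨x, y⟩ hp ⟨x', y'⟩ hq
    simp only [S, mem_iUnion, mem_prod] at hp hq
    obtain ⟨i, -, hx, hy⟩ := hp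
    obtain ⟨j, -, hx', hy'⟩ := hq
    refine ENNReal.ofReal_le_ofReal ?_
    have h1 : dist x y ≤ ε / 2 := (Metric.dist_le_diam_of_mem (hAb i) hx hy).trans (hAd i)
    have h2 : dist x' y' ≤ ε / 2 := (Metric.dist_le_diam_of_mem (hAb j) hx' hy').trans (hAd j)
    have h3 := dist_triangle4 x y y' x'
    have h4 := dist_triangle4 y x x' y'
    rw [dist_comm y' x'] at h3
    rw [dist_comm y x] at h4
    rw [abs_le]
    constructor <;> dsimp only <;> linarith
  · refine le_trans (tsub_le_tsub_left ?_ _) hk.le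
    dsimp only [θ]
    rw [Measure.finsetSum_apply]
    refine Finset.sum_le_sum fun i hi => ?_
    refine (min_le_inv_max_mul (measure_ne_top _ _) (measure_ne_top _ _)).trans ?_
    rw [Measure.smul_apply, smul_eq_mul]
    gcongr
    rw [Measure.prod_restrict]
    refine le_trans ?_ (measure_mono (subset_biUnion_of_mem (u := fun i => A i ×ˢ A i) hi))
    rw [Measure.restrict_apply_self, Measure.prod_prod]

/-! ### Limits along ultrafilters and closedness of direct sums -/

/-- Dominated convergence for series in `ℝ≥0∞`, along an arbitrary filter. -/
theorem tendsto_tsum_of_le {κ : Type*} {l : Filter κ} [l.NeBot] {f : κ → ℕ → ℝ≥0∞}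
    {g bound : ℕ → ℝ≥0∞} (hb : ∑' i, bound i ≠ ∞)
    (hf : ∀ i, Tendsto (fun k => f k i) l (𝓝 (g i))) (h : ∀ᶠ k in l, ∀ i, f k i ≤ bound i) :
    Tendsto (fun k => ∑' i, f k i) l (𝓝 (∑' i, g i)) := by
  have hbi : ∀ i, bound i ≠ ∞ := ENNReal.ne_top_of_tsum_ne_top hb
  have hg : ∀ i, g i ≤ bound i := fun i => le_of_tendsto (hf i) (h.mono fun k hk => hk i)
  have hgi : ∀ i, g i ≠ ∞ := fun i => ne_top_of_le_ne_top (hbi i) (hg i)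
  have hgs : ∑' i, g i ≠ ∞ := ne_top_of_le_ne_top hb (ENNReal.tsum_le_tsum hg)
  have key : Tendsto (fun k => ∑' i, (f k i).toReal) l (𝓝 (∑' i, (g i).toReal)) := by
    refine tendsto_tsum_of_dominated_convergence (bound := fun i => (bound i).toReal)
      (ENNReal.summable_toReal hb) (fun i => (ENNReal.tendsto_toReal (hgi i)).comp (hf i)) ?_
    filter_upwards [h] with k hk i
    rw [Real.norm_of_nonneg ENNReal.toReal_nonneg]
    exact ENNReal.toReal_mono (hbi i) (hk i)
  rw [← ENNReal.tsum_toReal_eq hgi] at key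
  refine ((ENNReal.tendsto_ofReal key).congr' ?_).trans_eq (by rw [ENNReal.ofReal_toReal hgs])
  filter_upwards [h] with k hk
  rw [← ENNReal.tsum_toReal_eq fun i => ne_top_of_le_ne_top (hbi i) (hk i), ENNReal.ofReal_toReal]
  exact ne_top_of_le_ne_top hb (ENNReal.tsum_le_tsum hk)

/-- Measures dominated by a fixed finite measure converge setwise along every ultrafilter. The
domination gives the countable additivity of the limit. -/
theorem exists_setwise_limit {κ E : Type*} [MeasurableSpace E] (U : Ultrafilter κ)
    {μ : Measure E} [IsFiniteMeasure μ] {ν : κ → ProbabilityMeasure E} {C : ℝ≥0∞} (hC : C ≠ ∞)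
    (h : ∀ᶠ k in (U : Filter κ), ∀ A, MeasurableSet A → (ν k : Measure E) A ≤ C * μ A) :
    ∃ ξ : ProbabilityMeasure E, ∀ A, MeasurableSet A →
      Tendsto (fun k => (ν k : Measure E) A) U (𝓝 ((ξ : Measure E) A)) := by
  let L : Set E → ℝ≥0∞ := fun A => (U.map fun k => (ν k : Measure E) A).lim
  have hL : ∀ A, Tendsto (fun k => (ν k : Measure E) A) U (𝓝 (L A)) := fun A =>
    (U.map fun k => (ν k : Measure E) A).le_nhds_lim
  let m : Measure E := Measure.ofMeasurable (fun A _ => L A)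
    (tendsto_nhds_unique (hL ∅) (by simp)) (fun A hA hd => by
      refine tendsto_nhds_unique (hL _) ?_
      have hb : ∑' i, C * μ (A i) ≠ ∞ := by
        rw [ENNReal.tsum_mul_left, ← measure_iUnion hd hA]
        exact ENNReal.mul_ne_top hC (measure_ne_top _ _)
      refine (tendsto_tsum_of_le hb (fun i => hL (A i)) (h.mono fun k hk i => hk _ (hA i))).congr ?_
      intro k
      rw [measure_iUnion hd hA])
  have hm : ∀ A, MeasurableSet A → m A = L A := fun A hA => Measure.ofMeasurable_apply A hA
  refine ⟨⟨m, ⟨?_⟩⟩, fun A hA => ?_⟩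
  · rw [hm _ MeasurableSet.univ]
    exact tendsto_nhds_unique (hL univ) (by simp)
  · rw [ProbabilityMeasure.coe_mk, hm A hA]
    exact hL A

theorem box_le_one (X Y : MMSpace) : box X Y ≤ 1 := by
  refine (box_le_of_subcoupling (X := X) (Y := Y) (θ := 0) (S := ∅) ?_ ?_
    MeasurableSet.empty).trans (max_le ?_ tsub_le_self)
  · simp [Measure.zero_le]
  · simp [Measure.zero_le]
  · exact distortion_le (by simp)

theorem boxTo_le {X Y : MMSpace} {P : Set MMSpace} (hY : Y ∈ P) : boxTo X P ≤ box X Y :=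
  iInf₂_le Y hY

theorem exists_box_lt_of_boxTo_lt {X : MMSpace} {P : Set MMSpace} {ε : ℝ≥0∞}
    (h : boxTo X P < ε) : ∃ Y ∈ P, box X Y < ε := by
  simpa only [boxTo, iInf_lt_iff, exists_prop] using h

theorem IsWeight.abs_sub_le_l1dist {N N' : ℕ∞} {a b : ℕ → ℝ} (ha : IsWeight N a)
    (hb : IsWeight N' b) (n : ℕ) : |a n - b n| ≤ l1dist a b :=
  (ha.summable_abs_sub hb).le_tsum n fun _ _ => abs_nonneg _

theorem IsWeight.tendsto_apply {N N' : ℕ∞} {a : ℕ → ℝ} {A : ℕ → ℕ → ℝ} (ha : IsWeight N a)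
    (hA : ∀ k, IsWeight N' (A k)) (h : Tendsto (fun k => l1dist (A k) a) atTop (𝓝 0)) (n : ℕ) :
    Tendsto (fun k => A k n) atTop (𝓝 (a n)) := by
  rw [tendsto_iff_dist_tendsto_zero]
  exact squeeze_zero (fun _ => dist_nonneg) (fun k => (hA k).abs_sub_le_l1dist ha n) h

/-- Mixtures of the same measures with two weights differ by at most the `ℓ¹`-distance. -/
theorem tsum_mul_le_add_l1dist {N N' : ℕ∞} {a b : ℕ → ℝ} (ha : IsWeight N a)
    (hb : IsWeight N' b) {x : ℕ → ℝ≥0∞} (hx : ∀ n, x n ≤ 1) :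
    ∑' n, ENNReal.ofReal (a n) * x n ≤
      ∑' n, ENNReal.ofReal (b n) * x n + ENNReal.ofReal (l1dist a b) := by
  rw [l1dist, ENNReal.ofReal_tsum_of_nonneg (fun n => abs_nonneg _) (ha.summable_abs_sub hb),
    ← ENNReal.tsum_add]
  refine ENNReal.tsum_le_tsum fun n => ?_
  have := mul_le_mul_add_abs_sub (ha.le_one n) (hb.nonneg n) (hx n)
    (le_add_right le_rfl : x n ≤ x n + 0)
  rwa [zero_add] at this

theorem l1dist_self (a : ℕ → ℝ) : l1dist a a = 0 := by
  simp [l1dist]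

/-- A cluster point of elements of direct sums of weakly convergent sequences belongs to the direct
sum of the limits. The decompositions of the measures of the approximating spaces are transported
to `X`, where their components are dominated by multiples of `μ_X` and hence converge setwise along
an ultrafilter; the limit components lie in the limit pyramids. -/
theorem mem_directSum_of_mapClusterPt {N : ℕ∞} {a : ℕ → ℝ} {A : ℕ → ℕ → ℝ} {P : ℕ → Set MMSpace}
    {Q : ℕ → ℕ → Set MMSpace} (ha : IsWeight N a) (hA : ∀ k, IsWeight N (A k))
    (hP : ∀ n : ℕ, (n : ℕ∞) < N → IsPyramid (P n))
    (hQ : ∀ k n : ℕ, (n : ℕ∞) < N → IsPyramid (Q k n))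
    (hAa : Tendsto (fun k => l1dist (A k) a) atTop (𝓝 0))
    (hQP : ∀ n : ℕ, (n : ℕ∞) < N → ∀ X, X ∉ P n → 0 < liminf (fun k => boxTo X (Q k n)) atTop)
    {X : MMSpace} (hX : MapClusterPt 0 atTop fun k => boxTo X (directSum N (A k) (Q k))) :
    X ∈ directSum N a P := by
  obtain ⟨U, hU, hUX⟩ := mapClusterPt_iff_ultrafilter.1 hX
  let e : ℕ → ℝ≥0∞ := fun k => boxTo X (directSum N (A k) (Q k)) + ((k + 1 : ℕ) : ℝ≥0∞)⁻¹
  have he : Tendsto e U (𝓝 0) := by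
    have h1 : Tendsto (fun k : ℕ => ((k + 1 : ℕ) : ℝ≥0∞)⁻¹) U (𝓝 0) :=
      ((tendsto_add_atTop_iff_nat 1).2 ENNReal.tendsto_inv_nat_nhds_zero).mono_left hU
    have h2 := hUX.add h1
    rwa [add_zero] at h2
  have hdec : ∀ k, ∃ (Y : MMSpace) (ν : ℕ → ProbabilityMeasure Y) (ν' : ℕ → ProbabilityMeasure X),
      (∀ n : ℕ, (n : ℕ∞) < N → Y.withMeasure (ν n) ∈ Q k n) ∧
      X.μ = Measure.sum (fun n => ENNReal.ofReal (A k n) • (ν' n : Measure X)) ∧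
      ∀ n : ℕ, (n : ℕ∞) < N →
        box (X.withMeasure (ν' n)) (Y.withMeasure (ν n)) ≤ e k / ENNReal.ofReal (A k n) := by
    intro k
    have hlt : boxTo X (directSum N (A k) (Q k)) < e k := by
      refine ENNReal.lt_add_right ?_ (by simp)
      obtain ⟨W, hW⟩ := directSum_nonempty (hA k) (hQ k)
      exact ne_top_of_le_ne_top ENNReal.one_ne_top ((boxTo_le hW).trans (box_le_one _ _))
    obtain ⟨Y, hY, hbox⟩ := exists_box_lt_of_boxTo_lt hlt
    obtain ⟨ν, hν, hYμ⟩ := (mem_directSum_iff (hA k) (hQ k)).1 hY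
    obtain ⟨ν', hν', hb⟩ := exists_decomposition_of_box_lt hbox (hA k) hYμ
    exact ⟨Y, ν, ν', hν, hν', hb⟩
  choose Y ν ν' hν hν' hb using hdec
  have hAU : ∀ n, Tendsto (fun k => A k n) U (𝓝 (a n)) := fun n =>
    (ha.tendsto_apply hA hAa n).mono_left hU
  have hlim : ∀ n : ℕ, ∃ ξ : ProbabilityMeasure X, (n : ℕ∞) < N → ∀ B, MeasurableSet B →
      Tendsto (fun k => (ν' k n : Measure X) B) U (𝓝 ((ξ : Measure X) B)) := by
    intro n
    by_cases hn : (n : ℕ∞) < N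
    · have hpos := ha.pos n hn
      obtain ⟨ξ, hξ⟩ := exists_setwise_limit U (μ := X.μ) (ν := fun k => ν' k n)
        (C := (ENNReal.ofReal (a n / 2))⁻¹) (by simpa using hpos) (by
          filter_upwards [(hAU n).eventually_const_lt (half_lt_self hpos)] with k hk B hB
          have h0 : ENNReal.ofReal (a n / 2) ≠ 0 := by simpa using hpos
          rw [mul_comm, ← div_eq_mul_inv,
            ENNReal.le_div_iff_mul_le (Or.inl h0) (Or.inl ENNReal.ofReal_ne_top), mul_comm]
          calc ENNReal.ofReal (a n / 2) * (ν' k n : Measure X) B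
              ≤ ENNReal.ofReal (A k n) * (ν' k n : Measure X) B := by gcongr
            _ ≤ X.μ B := by
                conv_rhs => rw [hν' k]
                exact smul_le_sum (fun n => ENNReal.ofReal (A k n))
                  (fun n => (ν' k n : Measure X)) n B)
      exact ⟨ξ, fun _ => hξ⟩
    · exact ⟨X.prob, fun h => absurd h hn⟩
  choose ξ hξ using hlim
  refine (mem_directSum_iff ha hP).2 ⟨ξ, fun n hn => ?_, ?_⟩
  · by_contra hcon
    obtain ⟨c, hc, hc'⟩ := exists_between (hQP n hn _ hcon)
    have hev := (eventually_lt_of_lt_liminf hc').filter_mono hU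
    have hc2 : 0 < c / 2 := ENNReal.div_pos hc.ne' (by simp)
    have h1 := (tendsto_box_of_setwise (hξ n hn)).eventually_lt_const hc2
    have h2 : Tendsto (fun k => e k / ENNReal.ofReal (A k n)) U (𝓝 0) := by
      have h0 : ENNReal.ofReal (a n) ≠ 0 := by simpa using ha.pos n hn
      simpa using ENNReal.Tendsto.div he (Or.inr h0) (ENNReal.tendsto_ofReal (hAU n))
        (Or.inl ENNReal.ofReal_ne_top)
    obtain ⟨k, hk, hk1, hk2⟩ := (hev.and (h1.and (h2.eventually_lt_const hc2))).exists
    have h3 := box_le_add hk1 ((hb k n hn).trans_lt hk2)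
    rw [ENNReal.add_halves] at h3
    exact absurd (hk.trans_le ((boxTo_le (hν k n hn)).trans h3)) (lt_irrefl _)
  · ext B hB
    rw [Measure.sum_apply _ hB]
    simp only [Measure.smul_apply, smul_eq_mul]
    have hsum : ∀ k, X.μ B = ∑' n, ENNReal.ofReal (A k n) * (ν' k n : Measure X) B := by
      intro k
      conv_lhs => rw [hν' k]
      rw [Measure.sum_apply _ hB]
      simp only [Measure.smul_apply, smul_eq_mul]
    have hT : Tendsto (fun k => ∑' n, ENNReal.ofReal (a n) * (ν' k n : Measure X) B) U
        (𝓝 (∑' n, ENNReal.ofReal (a n) * (ξ n : Measure X) B)) := by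
      refine tendsto_tsum_of_le (bound := fun n => ENNReal.ofReal (a n)) (by simp [ha.tsum_ofReal])
        (fun n => ?_) (Eventually.of_forall fun k n => mul_le_of_le_one_right zero_le prob_le_one)
      by_cases hn : (n : ℕ∞) < N
      · exact ENNReal.Tendsto.const_mul (hξ n hn B hB) (Or.inr ENNReal.ofReal_ne_top)
      · simp [ha.zero n (not_lt.1 hn)]
    have hl : Tendsto (fun k => ENNReal.ofReal (l1dist (A k) a)) U (𝓝 0) := by
      simpa using ENNReal.tendsto_ofReal (hAa.mono_left hU)
    refine le_antisymm ?_ ?_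
    · refine ge_of_tendsto (by simpa using hT.add hl) (Eventually.of_forall fun k => ?_)
      rw [hsum k]
      exact tsum_mul_le_add_l1dist (hA k) ha fun n => prob_le_one
    · have hl' : Tendsto (fun k => X.μ B + ENNReal.ofReal (l1dist (A k) a)) U (𝓝 (X.μ B)) := by
        simpa using (tendsto_const_nhds (x := X.μ B)).add hl
      refine le_of_tendsto_of_tendsto' hT hl' fun k => ?_
      rw [hsum k, l1dist_comm]
      exact tsum_mul_le_add_l1dist ha (hA k) fun n => prob_le_one

theorem isPyramid_directSum {N : ℕ∞} {a : ℕ → ℝ} {P : ℕ → Set MMSpace} (ha : IsWeight N a)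
    (hP : ∀ n : ℕ, (n : ℕ∞) < N → IsPyramid (P n)) : IsPyramid (directSum N a P) where
  nonempty := directSum_nonempty ha hP
  -- A direct sum is closed by the case of constant sequences of weights and pyramids.
  closed X hX := by
    refine mem_directSum_of_mapClusterPt (A := fun _ => a) (Q := fun _ => P) ha (fun _ => ha) hP
      (fun _ => hP) (by simp [l1dist_self]) (fun n hn Y hY => ?_) ?_
    · rw [liminf_const]
      exact pos_iff_ne_zero.2 fun h => hY ((hP n hn).closed Y h)
    · rw [hX]
      exact tendsto_const_nhds.mapClusterPt
  down _ _ hY h := directSum_down ha hP hY h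
  directed _ hX _ hY := directSum_directed ha hP hX hY

theorem liminf_boxTo_directSum_pos {N : ℕ∞} {a : ℕ → ℝ} {A : ℕ → ℕ → ℝ} {P : ℕ → Set MMSpace}
    {Q : ℕ → ℕ → Set MMSpace} (ha : IsWeight N a) (hA : ∀ k, IsWeight N (A k))
    (hP : ∀ n : ℕ, (n : ℕ∞) < N → IsPyramid (P n))
    (hQ : ∀ k n : ℕ, (n : ℕ∞) < N → IsPyramid (Q k n))
    (hAa : Tendsto (fun k => l1dist (A k) a) atTop (𝓝 0))
    (hQP : ∀ n : ℕ, (n : ℕ∞) < N → ∀ X, X ∉ P n → 0 < liminf (fun k => boxTo X (Q k n)) atTop)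
    {X : MMSpace} (hX : X ∉ directSum N a P) :
    0 < liminf (fun k => boxTo X (directSum N (A k) (Q k))) atTop := by
  by_contra hcon
  refine hX (mem_directSum_of_mapClusterPt ha hA hP hQ hAa hQP ?_)
  rw [ENNReal.nhds_zero_basis.mapClusterPt_iff_frequently]
  intro ε hε
  by_contra hfr
  rw [not_frequently] at hfr
  refine hcon (lt_of_lt_of_le hε (le_liminf_of_le (by isBoundedDefault) ?_))
  filter_upwards [hfr] with k hk
  simpa using hk

/-! ### Approximation of elements of the limit and weak convergence -/

/-- Finitely many closed balls of radius `δ` cover a space up to measure `δ`. -/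
theorem exists_finite_net (X : MMSpace) {δ : ℝ} (hδ : 0 < δ) :
    ∃ (L : ℕ) (c : Fin L → X), X.μ {x | ∀ i, δ < dist x (c i)} ≤ ENNReal.ofReal δ := by
  let u : ℕ → X := TopologicalSpace.denseSeq X
  let K : ℕ → Set X := fun L => {x | ∀ i : ℕ, i < L → δ < dist x (u i)}
  have hKm : ∀ L, MeasurableSet (K L) := fun L => by
    simp only [K, ofPred_forall]
    exact MeasurableSet.iInter fun i => MeasurableSet.iInter fun _ =>
      measurableSet_lt measurable_const (measurable_id.dist measurable_const)
  have hKa : Antitone K := fun L L' hL x hx i hi => hx i (hi.trans_le hL)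
  have hKe : ⋂ L, K L = ∅ := by
    rw [eq_empty_iff_forall_notMem]
    intro x hx
    obtain ⟨i, hi⟩ := (TopologicalSpace.denseRange_denseSeq X).exists_dist_lt x hδ
    exact absurd (mem_iInter.1 hx (i + 1) i (Nat.lt_succ_self i)) (not_lt.2 hi.le)
  have ht := tendsto_measure_iInter_atTop (μ := X.μ) (fun L => (hKm L).nullMeasurableSet) hKa
    ⟨0, measure_ne_top _ _⟩
  rw [hKe, measure_empty] at ht
  obtain ⟨L, hL⟩ := (ht.eventually_lt_const (ENNReal.ofReal_pos.2 hδ)).exists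
  exact ⟨L, fun i => u i, (measure_mono (t := K L) fun x
    (hx : ∀ i : Fin L, δ < dist x (u i)) i hi => hx ⟨i, hi⟩).trans hL.le⟩

/-- A nonnegative `1`-Lipschitz map on `X` is transported to a `1`-Lipschitz map on a space `Y` near
`X`, by McShane's extension formula for the relation of small distortion between them. -/
theorem exists_lipschitz_transport {X Y : MMSpace} {ε : ℝ} (hε : 0 ≤ ε)
    (h : box X Y < ENNReal.ofReal ε) {L : ℕ} {φ : X → Fin L → ℝ} (hφ : LipschitzWith 1 φ)
    (hφ0 : ∀ x i, 0 ≤ φ x i) :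
    ∃ ψ : Y → Fin L → ℝ, LipschitzWith 1 ψ ∧ ∃ π : Measure (X × Y),
      IsCoupling (X := X) (Y := Y) π ∧
      π {p | ε < dist (φ p.1) (ψ p.2)} ≤ ENNReal.ofReal ε := by
  obtain ⟨π, hπ, S, hS, hSd, hSm⟩ := exists_coupling_of_box_lt h
  rcases S.eq_empty_or_nonempty with rfl | hne
  · refine ⟨fun _ => 0, LipschitzWith.const' 0, π, hπ, (measure_mono (subset_univ _)).trans ?_⟩
    rwa [compl_empty] at hSm
  have : Nonempty S := hne.to_subtype
  have hφd : ∀ x x' i, φ x i ≤ φ x' i + dist x x' := fun x x' i => by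
    have h1 := (dist_le_pi_dist (φ x) (φ x') i).trans (hφ.dist_le_mul x x')
    rw [Real.dist_eq, NNReal.coe_one, one_mul] at h1
    linarith [le_abs_self (φ x i - φ x' i)]
  have hbdd : ∀ y i, BddBelow (range fun s : S => φ s.1.1 i + dist y s.1.2) := fun y i =>
    ⟨0, by rintro _ ⟨s, rfl⟩; exact add_nonneg (hφ0 _ _) dist_nonneg⟩
  let ψ : Y → Fin L → ℝ := fun y i => ⨅ s : S, (φ s.1.1 i + dist y s.1.2)
  have hψ : ∀ y y' i, ψ y i ≤ ψ y' i + dist y y' := fun y y' i => by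
    rw [← sub_le_iff_le_add]
    refine le_ciInf fun s => ?_
    have h1 : ψ y i ≤ φ s.1.1 i + dist y s.1.2 := ciInf_le (hbdd y i) s
    linarith [dist_triangle y y' s.1.2]
  refine ⟨ψ, LipschitzWith.of_dist_le_mul fun y y' => ?_, π, hπ, ?_⟩
  · rw [NNReal.coe_one, one_mul, dist_pi_le_iff dist_nonneg]
    intro i
    rw [Real.dist_eq, abs_le]
    have h1 := hψ y y' i
    have h2 := hψ y' y i
    rw [dist_comm] at h2
    constructor <;> linarith
  · refine (measure_mono fun p hp hpS => ?_).trans hSm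
    refine absurd hp (not_lt.2 ((dist_pi_le_iff hε).2 fun i => ?_))
    have h1 : ψ p.2 i ≤ φ p.1 i := by
      have := ciInf_le (hbdd p.2 i) ⟨p, hpS⟩
      simpa using this
    have h2 : φ p.1 i - ε ≤ ψ p.2 i := by
      refine le_ciInf fun s => ?_
      have h3 := (ENNReal.ofReal_le_ofReal_iff hε).1 ((ofReal_le_distortion hpS s.2).trans hSd)
      linarith [hφd p.1 s.1.1 i, le_abs_self (dist p.1 s.1.1 - dist p.2 s.1.2)]
    rw [Real.dist_eq, abs_le]
    constructor <;> linarith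

/-- If the components of a decomposition of `μ_X` are close to pyramids, then `X` is close to their
direct sum. The space approximating `X` is `ℝ^L` with a measure close to the image of `μ_X`
under the distances from the points of a finite net. -/
theorem boxTo_directSum_le {N : ℕ∞} {a b : ℕ → ℝ} {Q : ℕ → Set MMSpace} (ha : IsWeight N a)
    (hb : IsWeight N b) (hQ : ∀ n : ℕ, (n : ℕ∞) < N → IsPyramid (Q n)) {X : MMSpace}
    {ν : ℕ → ProbabilityMeasure X}
    (hν : X.μ = Measure.sum fun n => ENNReal.ofReal (a n) • (ν n : Measure X)) {M : ℕ} {δ : ℝ}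
    (hδ : 0 < δ) (hbox : ∀ n : ℕ, n < M → (n : ℕ∞) < N →
      boxTo (X.withMeasure (ν n)) (Q n) < ENNReal.ofReal δ) :
    boxTo X (directSum N b Q) ≤ max (ENNReal.ofReal (4 * δ))
      (ENNReal.ofReal (l1dist a b) + ∑' n, ENNReal.ofReal (a (n + M)) +
        (ENNReal.ofReal δ + ENNReal.ofReal δ)) := by
  obtain ⟨L, c, hc⟩ := X.exists_finite_net hδ
  let φ : X → Fin L → ℝ := fun x i => dist x (c i)
  have hφ : LipschitzWith 1 φ := LipschitzWith.of_dist_le_mul fun x x' => by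
    rw [NNReal.coe_one, one_mul, dist_pi_le_iff dist_nonneg]
    exact fun i => dist_dist_dist_le_left x x' (c i)
  have hφ' : ∀ x x', (∃ i, dist x (c i) ≤ δ) → dist x x' ≤ dist (φ x) (φ x') + 2 * δ := by
    rintro x x' ⟨i, hi⟩
    have h1 : dist (dist x (c i)) (dist x' (c i)) ≤ dist (φ x) (φ x') :=
      dist_le_pi_dist (φ x) (φ x') i
    rw [Real.dist_eq] at h1
    have h2 := neg_abs_le (dist x (c i) - dist x' (c i))
    have h3 := dist_triangle_right x x' (c i)
    linarith
  have hdis : ∀ (x x' : X) (z z' : Fin L → ℝ), (∃ i, dist x (c i) ≤ δ) → dist (φ x) z ≤ δ →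
      dist (φ x') z' ≤ δ → |dist x x' - dist z z'| ≤ 4 * δ := by
    intro x x' z z' hx hz hz'
    have h1 := hφ' x x' hx
    have h2 : dist (φ x) (φ x') ≤ dist x x' := by simpa using hφ.dist_le_mul x x'
    have h3 := dist_triangle4 (φ x) z z' (φ x')
    have h4 := dist_triangle4 z (φ x) (φ x') z'
    rw [dist_comm z' (φ x')] at h3
    rw [dist_comm z (φ x)] at h4
    rw [abs_le]
    constructor <;> linarith
  have key : ∀ n : ℕ, ∃ (ξ : ProbabilityMeasure (Fin L → ℝ)) (ζ : Measure (X × (Fin L → ℝ))),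
      ((n : ℕ∞) < N → ofMeasure ξ ∈ Q n) ∧ (n < M → (n : ℕ∞) < N →
        ζ.map Prod.fst = ν n ∧ ζ.map Prod.snd = ξ ∧
        ζ {p | δ < dist (φ p.1) p.2} ≤ ENNReal.ofReal δ) := by
    intro n
    let δ₀ : ProbabilityMeasure (Fin L → ℝ) := ⟨Measure.dirac 0, inferInstance⟩
    by_cases hn : (n : ℕ∞) < N
    swap
    · exact ⟨δ₀, 0, fun h => absurd h hn, fun _ h => absurd h hn⟩
    by_cases hnM : n < M
    swap
    · exact ⟨δ₀, 0, fun h => (hQ n h).dirac_mem (ofMeasure δ₀) (0 : Fin L → ℝ) δ₀ rfl,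
        fun h => absurd h hnM⟩
    obtain ⟨Y, hY, hYb⟩ := exists_box_lt_of_boxTo_lt (hbox n hnM hn)
    obtain ⟨ψ, hψ, π, hπ, hπm⟩ := exists_lipschitz_transport (X := X.withMeasure (ν n)) hδ.le hYb hφ
      fun _ _ => dist_nonneg
    have hψm : Measurable ψ := hψ.continuous.measurable
    have hm : Measurable fun p : X × Y => (p.1, ψ p.2) :=
      measurable_fst.prodMk (hψm.comp measurable_snd)
    refine ⟨Y.image ψ hψm.aemeasurable, π.map fun p => (p.1, ψ p.2), fun h => ?_, fun _ _ =>
      ⟨?_, ?_, ?_⟩⟩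
    · exact (hQ n h).down _ _ hY ⟨ψ, hψ.lipschitzOnWith, rfl⟩
    · rw [Measure.map_map measurable_fst hm]
      exact hπ.1
    · rw [Measure.map_map measurable_snd hm, coe_image, ← hπ.2, Measure.map_map hψm measurable_snd]
      rfl
    · rw [Measure.map_apply hm]
      · exact hπm
      · exact measurableSet_lt measurable_const
          ((hφ.continuous.measurable.comp measurable_fst).dist measurable_snd)
  choose ξ ζ hξ hζ using key
  let η : ProbabilityMeasure (Fin L → ℝ) := ⟨_, hb.sum_isProbabilityMeasure ξ⟩
  have hη : ofMeasure η ∈ directSum N b Q := (mem_directSum_iff hb hQ).2 ⟨ξ, hξ, rfl⟩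
  refine (boxTo_le hη).trans ?_
  let w : ℕ → ℝ≥0∞ := fun n => ENNReal.ofReal (min (a n) (b n))
  have hwa : ∀ n, w n ≤ ENNReal.ofReal (a n) := fun n => ENNReal.ofReal_le_ofReal (min_le_left _ _)
  have hwb : ∀ n, w n ≤ ENNReal.ofReal (b n) := fun n => ENNReal.ofReal_le_ofReal (min_le_right _ _)
  have hw0 : ∀ n : ℕ, ¬ (n : ℕ∞) < N → w n = 0 := fun n hn => le_antisymm
    ((hwa n).trans (by simp [ha.zero n (not_lt.1 hn)])) zero_le
  let θ : Measure (X × (Fin L → ℝ)) := ∑ n ∈ Finset.range M, w n • ζ n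
  let S : Set (X × (Fin L → ℝ)) := {p | (∃ i, dist p.1 (c i) ≤ δ) ∧ dist (φ p.1) p.2 ≤ δ}
  have hBm : MeasurableSet {p : X × (Fin L → ℝ) | δ < dist (φ p.1) p.2} :=
    measurableSet_lt measurable_const
      ((hφ.continuous.measurable.comp measurable_fst).dist measurable_snd)
  have hKm : MeasurableSet {x : X | ∀ i, δ < dist x (c i)} := by
    simp only [ofPred_forall]
    exact MeasurableSet.iInter fun i =>
      measurableSet_lt measurable_const (measurable_id.dist measurable_const)
  have hSc : Sᶜ = Prod.fst ⁻¹' {x : X | ∀ i, δ < dist x (c i)} ∪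
      {p : X × (Fin L → ℝ) | δ < dist (φ p.1) p.2} := by
    ext p
    simp only [S, mem_compl_iff, mem_ofPred_eq, not_and_or, not_exists, not_le, mem_union,
      mem_preimage]
  have hSm : MeasurableSet S := by
    rw [← MeasurableSet.compl_iff, hSc]
    exact (measurable_fst hKm).union hBm
  have hθ1 : θ.map Prod.fst ≤ X.μ := by
    rw [← Measure.mapₗ_apply_of_measurable measurable_fst, map_sum, hν]
    refine Measure.le_iff.2 fun s hs => ?_
    rw [Measure.finsetSum_apply, Measure.sum_apply _ hs]
    refine le_trans (Finset.sum_le_sum fun n hn => ?_) (ENNReal.sum_le_tsum (Finset.range M))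
    rw [Measure.mapₗ_apply_of_measurable measurable_fst, Measure.map_smul]
    by_cases hnN : (n : ℕ∞) < N
    · rw [(hζ n (Finset.mem_range.1 hn) hnN).1, Measure.smul_apply, Measure.smul_apply, smul_eq_mul,
        smul_eq_mul]
      gcongr
      exact hwa n
    · simp [hw0 n hnN]
  have hθ2 : θ.map Prod.snd ≤ (η : Measure (Fin L → ℝ)) := by
    rw [← Measure.mapₗ_apply_of_measurable measurable_snd, map_sum]
    refine Measure.le_iff.2 fun s hs => ?_
    rw [Measure.finsetSum_apply, ProbabilityMeasure.coe_mk, Measure.sum_apply _ hs]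
    refine le_trans (Finset.sum_le_sum fun n hn => ?_) (ENNReal.sum_le_tsum (Finset.range M))
    rw [Measure.mapₗ_apply_of_measurable measurable_snd, Measure.map_smul]
    by_cases hnN : (n : ℕ∞) < N
    · rw [(hζ n (Finset.mem_range.1 hn) hnN).2.1, Measure.smul_apply, Measure.smul_apply,
        smul_eq_mul, smul_eq_mul]
      gcongr
      exact hwb n
    · simp [hw0 n hnN]
  refine (box_le_of_subcoupling (X := X) (Y := ofMeasure η) hθ1 hθ2 hSm).trans
    (max_le_max ?_ ?_)
  · refine distortion_le ?_
    rintro ⟨x, z⟩ ⟨hx, hz⟩ ⟨x', z'⟩ ⟨-, hz'⟩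
    refine ENNReal.ofReal_le_ofReal ?_
    exact hdis x x' z z' hx hz hz'
  · have hB : θ {p : X × (Fin L → ℝ) | δ < dist (φ p.1) p.2} ≤ ENNReal.ofReal δ := by
      dsimp only [θ]
      rw [Measure.finsetSum_apply]
      calc _ ≤ ∑ n ∈ Finset.range M, ENNReal.ofReal (a n) * ENNReal.ofReal δ := by
            refine Finset.sum_le_sum fun n hn => ?_
            rw [Measure.smul_apply, smul_eq_mul]
            by_cases hnN : (n : ℕ∞) < N
            · gcongr
              · exact hwa n
              · exact (hζ n (Finset.mem_range.1 hn) hnN).2.2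
            · simp [hw0 n hnN]
        _ ≤ 1 * ENNReal.ofReal δ := by
            rw [← Finset.sum_mul, ← ha.tsum_ofReal]
            gcongr
            exact ENNReal.sum_le_tsum _
        _ = _ := one_mul _
    have hK : θ (Prod.fst ⁻¹' {x : X | ∀ i, δ < dist x (c i)}) ≤ ENNReal.ofReal δ := by
      rw [← Measure.map_apply measurable_fst hKm]
      exact (hθ1 _).trans hc
    have hθu : θ univ = ∑ n ∈ Finset.range M, w n := by
      dsimp only [θ]
      rw [Measure.finsetSum_apply]
      refine Finset.sum_congr rfl fun n hn => ?_
      rw [Measure.smul_apply, smul_eq_mul]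
      by_cases hnN : (n : ℕ∞) < N
      · have h1 : (ζ n) univ = 1 := by
          rw [← preimage_univ (f := Prod.fst),
            ← Measure.map_apply measurable_fst MeasurableSet.univ,
            (hζ n (Finset.mem_range.1 hn) hnN).1, measure_univ]
        rw [h1, mul_one]
      · simp [hw0 n hnN]
    have haw : ∑ n ∈ Finset.range M, ENNReal.ofReal (a n) ≤
        ∑ n ∈ Finset.range M, w n + ENNReal.ofReal (l1dist a b) := by
      rw [l1dist, ENNReal.ofReal_tsum_of_nonneg (fun n => abs_nonneg _) (ha.summable_abs_sub hb)]
      refine le_trans ?_ (add_le_add le_rfl (ENNReal.sum_le_tsum (Finset.range M)))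
      rw [← Finset.sum_add_distrib]
      refine Finset.sum_le_sum fun n _ => ?_
      rw [← ENNReal.ofReal_add (le_min (ha.nonneg n) (hb.nonneg n)) (abs_nonneg _)]
      refine ENNReal.ofReal_le_ofReal ?_
      rcases min_choice (a n) (b n) with h | h <;> rw [h]
      · linarith [abs_nonneg (a n - b n)]
      · linarith [le_abs_self (a n - b n)]
    rw [tsub_le_iff_left]
    calc (1 : ℝ≥0∞) = ∑ n ∈ Finset.range M, ENNReal.ofReal (a n) +
          ∑' n, ENNReal.ofReal (a (n + M)) := by
          rw [← ha.tsum_ofReal]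
          exact (ENNReal.summable.sum_add_tsum_nat_add' (k := M)).symm
      _ ≤ (θ univ + ENNReal.ofReal (l1dist a b)) + ∑' n, ENNReal.ofReal (a (n + M)) := by
          rw [hθu]
          gcongr
      _ ≤ ((θ S + (ENNReal.ofReal δ + ENNReal.ofReal δ)) + ENNReal.ofReal (l1dist a b)) +
          ∑' n, ENNReal.ofReal (a (n + M)) := by
          gcongr
          rw [← measure_add_measure_compl hSm, hSc]
          exact add_le_add le_rfl ((measure_union_le _ _).trans (add_le_add hK hB))
      _ = _ := by ac_rfl

theorem tendsto_boxTo_directSum {N : ℕ∞} {a : ℕ → ℝ} {A : ℕ → ℕ → ℝ} {P : ℕ → Set MMSpace}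
    {Q : ℕ → ℕ → Set MMSpace} (ha : IsWeight N a) (hA : ∀ k, IsWeight N (A k))
    (hP : ∀ n : ℕ, (n : ℕ∞) < N → IsPyramid (P n))
    (hQ : ∀ k n : ℕ, (n : ℕ∞) < N → IsPyramid (Q k n))
    (hAa : Tendsto (fun k => l1dist (A k) a) atTop (𝓝 0))
    (hQP : ∀ n : ℕ, (n : ℕ∞) < N → ∀ X ∈ P n,
      Tendsto (fun k => boxTo X (Q k n)) atTop (𝓝 0))
    {X : MMSpace} (hX : X ∈ directSum N a P) :
    Tendsto (fun k => boxTo X (directSum N (A k) (Q k))) atTop (𝓝 0) := by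
  obtain ⟨ν, hν, hXν⟩ := (mem_directSum_iff ha hP).1 hX
  rw [ENNReal.tendsto_nhds_zero]
  intro ε' hε'
  obtain ⟨δ, hδ, hδε⟩ : ∃ δ : ℝ, 0 < δ ∧ ENNReal.ofReal (4 * δ) ≤ ε' := by
    obtain ⟨r, hr, hr'⟩ := ENNReal.lt_iff_exists_nnreal_btwn.1 hε'
    have hr0 : (0 : ℝ) < r := by exact_mod_cast hr
    exact ⟨r / 4, by positivity, by rw [mul_div_cancel₀ _ (by norm_num)]; simpa using hr'.le⟩
  have hδ' : 0 < ENNReal.ofReal δ := ENNReal.ofReal_pos.2 hδ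
  obtain ⟨M, hM⟩ : ∃ M, ∑' n, ENNReal.ofReal (a (n + M)) < ENNReal.ofReal δ :=
    ((ENNReal.tendsto_sum_nat_add (fun n => ENNReal.ofReal (a n))
      (by simp [ha.tsum_ofReal])).eventually_lt_const hδ').exists
  have h1 : ∀ᶠ k in atTop, ∀ n ∈ Finset.range M, (n : ℕ∞) < N →
      boxTo (X.withMeasure (ν n)) (Q k n) < ENNReal.ofReal δ := by
    rw [Finset.eventually_all]
    intro n _
    by_cases hn : (n : ℕ∞) < N
    · exact ((hQP n hn _ (hν n hn)).eventually_lt_const hδ').mono fun k hk _ => hk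
    · exact Eventually.of_forall fun k h => absurd h hn
  filter_upwards [h1, hAa.eventually_lt_const hδ] with k hk hl
  refine (boxTo_directSum_le ha (hA k) (hQ k) hXν hδ
    fun n hn => hk n (Finset.mem_range.2 hn)).trans (le_trans (max_le le_rfl ?_) hδε)
  rw [show 4 * δ = δ + δ + (δ + δ) by ring, ENNReal.ofReal_add (by positivity) (by positivity),
    ENNReal.ofReal_add hδ.le hδ.le]
  rw [l1dist_comm]
  gcongr

end MMSpace

theorem mainTheorem6 :
    -- the estimate of the distance between direct sums
    (∀ (N N' : ℕ∞) (a b : ℕ → ℝ) (P Q : ℕ → Set MMSpace),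
      MMSpace.IsWeight N a → MMSpace.IsWeight N' b →
      (∀ n : ℕ, (n : ℕ∞) < N → MMSpace.IsPyramid (P n)) →
      (∀ n : ℕ, (n : ℕ∞) < N' → MMSpace.IsPyramid (Q n)) →
      ∀ M : ℕ, 1 ≤ M → (M : ℕ∞) ≤ min N N' →
        MMSpace.rho (MMSpace.directSum N a P) (MMSpace.directSum N' b Q) ≤
          ∑ n ∈ Finset.range M, MMSpace.rho (P n) (Q n) +
            ENNReal.ofReal (1 / 2 * MMSpace.l1dist a b + 1 / 2 * ∑' n, a (n + M) +
              1 / 2 * ∑' n, b (n + M))) ∧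
    -- the continuity of the direct sum
    (∀ (N : ℕ∞) (a : ℕ → ℝ) (A : ℕ → ℕ → ℝ) (P : ℕ → Set MMSpace) (Q : ℕ → ℕ → Set MMSpace),
      MMSpace.IsWeight N a → (∀ k, MMSpace.IsWeight N (A k)) →
      (∀ n : ℕ, (n : ℕ∞) < N → MMSpace.IsPyramid (P n)) →
      (∀ k n : ℕ, (n : ℕ∞) < N → MMSpace.IsPyramid (Q k n)) →
      Tendsto (fun k => MMSpace.l1dist (A k) a) atTop (𝓝 0) →
      (∀ n : ℕ, (n : ℕ∞) < N → MMSpace.WeaklyConverges (fun k => Q k n) (P n)) →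
        (∀ k, MMSpace.IsPyramid (MMSpace.directSum N (A k) (Q k))) ∧
        MMSpace.IsPyramid (MMSpace.directSum N a P) ∧
        MMSpace.WeaklyConverges (fun k => MMSpace.directSum N (A k) (Q k))
          (MMSpace.directSum N a P)) := by
  refine ⟨fun N N' a b P Q ha hb hP hQ M _ hM => MMSpace.rho_directSum_le ha hb hP hQ hM,
    fun N a A P Q ha hA hP hQ hAa hQP => ⟨fun k => MMSpace.isPyramid_directSum (hA k) (hQ k),
      MMSpace.isPyramid_directSum ha hP, fun X hX => ?_, fun X hX => ?_⟩⟩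
  · exact MMSpace.tendsto_boxTo_directSum ha hA hP hQ hAa (fun n hn => (hQP n hn).1) hX
  · exact MMSpace.liminf_boxTo_directSum_pos ha hA hP hQ hAa (fun n hn => (hQP n hn).2) hX
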